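/- Let $\mathbb H$ be the real quaternions. For a quaternion matrix $A$ let $r(A)$ be its rank (dimension of its right column space), $A^\dagger$ its Moore–Penrose inverse, $L_A=I-A^\dagger A$ and $R_A=I-AA^\dagger$. Let $A_i,B_i,C_i$ $(i=1,2,3,4)$ be quaternion matrices of compatible sizes, and consider the system in the unknown quaternion matrices $X_1,\dots,X_5$ $$A_1X_1-X_2B_1=C_1,\quad A_2X_3-X_2B_2=C_2,\quad A_3X_4-X_3B_3=C_3,\quad A_4X_4-X_5B_4=C_4.\qquad(\ast)$$ Put $$A_{11}=R_{B_2}B_1,\quad B_{11}=R_{A_1}A_2,\quad C_{11}=B_1L_{A_{11}},\quad D_{11}=R_{A_1}(R_{A_2}C_2B_2^\dagger B_1-C_1)L_{A_{11}},$$ $$A_{22}=R_{(A_4L_{A_3})}A_4,\quad B_{22}=B_3L_{B_4},\quad C_{22}=R_{(A_4L_{A_3})}(C_4-A_4A_3^\dagger C_3)L_{B_4},$$ $$A_{33}=(L_{A_2},\ -A_3L_{A_{22}}),\qquad B_{33}=\begin{pmatrix}R_{C_{11}}B_2\\-R_{B_3}\end{pmatrix},$$ $$E_1=-R_{A_3}C_3B_3^\dagger+A_3A_{22}^\dagger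 C_{22}B_{22}^\dagger-A_2^\dagger C_2-B_{11}^\dagger D_{11}C_{11}^\dagger B_2,$$ $$A=R_{A_{33}}L_{B_{11}},\quad B=B_2L_{B_{33}},\quad C=-R_{A_{33}}A_3,\quad D=R_{B_{22}}L_{B_{33}},$$ $$E=R_{A_{33}}E_1L_{B_{33}},\quad M=R_AC,\quad N=DL_B,\quad S=CL_M.$$ **Theorem.** The following statements are equivalent. (1) The system $(\ast)$ is consistent. (2) The following ten rank equalities hold, where $F:=A_2C_3+C_2B_3$: $$r\begin{pmatrix}C_i&A_i\\B_i&0\end{pmatrix}=r(A_i)+r(B_i)\quad(i=1,2,3,4),$$ $$r\begin{pmatrix}C_1&C_2&A_1&A_2\\B_1&B_2&0&0\end{pmatrix}=r(A_1,\ A_2)+r(B_1,\ B_2),$$ $$r\begin{pmatrix}C_3&A_3\\C_4&A_4\\B_3&0\\B_4&0\end{pmatrix}=r\begin{pmatrix}A_3\\A_4\end{pmatrix}+r\begin{pmatrix}B_3\\B_4\end{pmatrix},$$ $$r\begin{pmatrix}C_1&F&A_1&A_2A_3\\B_1&B_2B_3&0&0\end{pmatrix}=r(A_1,\ A_2A_3)+r(B_1,\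 B_2B_3),$$ $$r\begin{pmatrix}F&A_2A_3\\C_4&A_4\\B_2B_3&0\\B_4&0\end{pmatrix}=r\begin{pmatrix}A_2A_3\\A_4\end{pmatrix}+r\begin{pmatrix}B_2B_3\\B_4\end{pmatrix},$$ $$r\begin{pmatrix}F&A_2A_3\\B_2B_3&0\end{pmatrix}=r(A_2A_3)+r(B_2B_3),$$ $$r\begin{pmatrix}C_1&F&A_1&A_2A_3\\0&C_4&0&A_4\\B_1&B_2B_3&0&0\\0&B_4&0&0\end{pmatrix}=r\begin{pmatrix}A_1&A_2A_3\\0&A_4\end{pmatrix}+r\begin{pmatrix}B_1&B_2B_3\\0&B_4\end{pmatrix}.$$ (3) $$R_{A_2}C_2L_{B_2}=0,\quad D_{11}L_{C_{11}}=0,\quad R_{B_{11}}D_{11}=0,$$ $$R_{A_3}C_3L_{B_3}=0,\quad R_{A_{22}}C_{22}=0,\quad C_{22}L_{B_{22}}=0,$$ $$R_MR_AE=0,\quad EL_BL_N=0,\quad R_AEL_D=0,\quad R_CEL_B=0.$$ In this case the general solution of $(\ast)$ is $$X_1=A_1^\dagger(C_1-R_{A_2}C_2B_2^\dagger B_1+A_2U_1B_1)+W_4A_{11}+L_{A_1}W_6,$$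 $$X_2=-R_{A_2}C_2B_2^\dagger+A_2U_1+V_1R_{B_2},\qquad X_4=A_3^\dagger C_3+V_2B_3+L_{A_3}U_2,$$ $$X_5=-R_{(A_4L_{A_3})}(C_4-A_4A_3^\dagger C_3-A_4V_2B_3)B_4^\dagger+A_4L_{A_3}T_1+T_3R_{B_4},$$ $$X_3=A_2^\dagger C_2+U_1B_2+L_{A_2}W_1,\quad\text{or equivalently}\quad X_3=-R_{A_3}C_3B_3^\dagger+A_3V_2+T_6R_{B_3},$$ where $$U_1=B_{11}^\dagger D_{11}C_{11}^\dagger+L_{B_{11}}W_2+W_3R_{C_{11}},$$ $$V_1=-R_{A_1}(C_1-R_{A_2}C_2B_2^\dagger B_1+A_2U_1B_1)A_{11}^\dagger+A_1W_4+W_5R_{A_{11}},$$ $$V_2=A_{22}^\dagger C_{22}B_{22}^\dagger+L_{A_{22}}T_4+T_5R_{B_{22}},$$ $$U_2=(A_4L_{A_3})^\dagger(C_4-A_4A_3^\dagger C_3-A_4V_2B_3)+T_1B_4+L_{(A_4L_{A_3})}T_2,$$ $$\begin{pmatrix}W_1\\T_4\end{pmatrix}=A_{33}^\dagger(E_1-L_{B_{11}}W_2B_2+A_3T_5R_{B_{22}})-A_{33}^\dagger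 Z_7B_{33}+L_{A_{33}}Z_6,$$ $$(W_3,\ T_6)=R_{A_{33}}(E_1-L_{B_{11}}W_2B_2+A_3T_5R_{B_{22}})B_{33}^\dagger+A_{33}A_{33}^\dagger Z_7+Z_8R_{B_{33}},$$ $$W_2=A^\dagger EB^\dagger-A^\dagger CM^\dagger EB^\dagger-A^\dagger SC^\dagger EN^\dagger DB^\dagger-A^\dagger SZ_1R_NDB^\dagger+L_AZ_2+Z_3R_B,$$ $$T_5=M^\dagger ED^\dagger+S^\dagger SC^\dagger EN^\dagger+L_ML_SZ_4+L_MZ_1R_N+Z_5R_D,$$ with $W_4,W_5,W_6,T_1,T_2,T_3,Z_1,\dots,Z_8$ arbitrary quaternion matrices of compatible sizes, and where $W_1$, $T_4$ have as many rows as $A_2$, $A_4$ have columns, and $W_3$, $T_6$ have as many columns as $B_1$, $B_3$ have rows. That is, for every choice of the arbitrary matrices the two expressions for $X_3$ agree and $(X_1,\dots,X_5)$ solves $(\ast)$, and every solution of $(\ast)$ arises in this way. -/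

import Mathlib

open scoped Quaternion Matrix

noncomputable section

namespace QuatSylvester

/-! ### Rank, Moore–Penrose inverse and the induced projectors of a quaternion matrix -/

/-- The rank of a quaternion matrix: the dimension of its right column space, i.e. the maximal
number of right linearly independent columns.  (A right vector space over `ℍ` is a module
over `ℍᵐᵒᵖ`.) -/
def rk {m n : Type*} (A : Matrix m n ℍ[ℝ]) : ℕ :=
  Module.finrank ℍ[ℝ]ᵐᵒᵖ (Submodule.span ℍ[ℝ]ᵐᵒᵖ (Set.range A.col))

/-- `X` satisfies the four Penrose equations for `A`. -/
structure IsMoorePenrose {m n : Type*} [Fintype m] [Fintype n]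
    (A : Matrix m n ℍ[ℝ]) (X : Matrix n m ℍ[ℝ]) : Prop where
  mul_mul_self : A * X * A = A
  self_mul_mul : X * A * X = X
  left_herm : (A * X)ᴴ = A * X
  right_herm : (X * A)ᴴ = X * A

section MoorePenrose

variable {m n : Type*} [Fintype m] [Fintype n]

theorem IsMoorePenrose.unique {A : Matrix m n ℍ[ℝ]} {X Y : Matrix n m ℍ[ℝ]}
    (hX : IsMoorePenrose A X) (hY : IsMoorePenrose A Y) : X = Y := by
  have h1 : A * X = A * Y := by
    calc A * X = (A * X)ᴴ := hX.left_herm.symm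
      _ = (A * Y * (A * X))ᴴ := by
          rw [← Matrix.mul_assoc (A * Y) A X, hY.mul_mul_self]
      _ = A * X * (A * Y) := by
          rw [Matrix.conjTranspose_mul, hX.left_herm, hY.left_herm]
      _ = A * Y := by rw [← Matrix.mul_assoc (A * X) A Y, hX.mul_mul_self]
  have h2 : X * A = Y * A := by
    calc X * A = (X * A)ᴴ := hX.right_herm.symm
      _ = (X * A * (Y * A))ᴴ := by
          rw [Matrix.mul_assoc X A (Y * A), ← Matrix.mul_assoc A Y A, hY.mul_mul_self]
      _ = Y * A * (X * A) := by
          rw [Matrix.conjTranspose_mul, hX.right_herm, hY.right_herm]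
      _ = Y * A := by rw [Matrix.mul_assoc Y A (X * A), ← Matrix.mul_assoc A X A, hX.mul_mul_self]
  calc X = X * A * X := hX.self_mul_mul.symm
    _ = Y * A * Y := by rw [Matrix.mul_assoc, h1, ← Matrix.mul_assoc, h2]
    _ = Y := hY.self_mul_mul

theorem eq_zero_of_conjTranspose_mul_self {B : Matrix m n ℍ[ℝ]} (h : Bᴴ * B = 0) : B = 0 := by
  ext1 i j
  have hj : (Bᴴ * B) j j = 0 := by rw [h]; rfl
  have hs : ∑ k, Quaternion.normSq (B k j) = 0 := by
    have hc : ((∑ k, Quaternion.normSq (B k j) : ℝ) : ℍ[ℝ]) = 0 := by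
      rw [← hj, Matrix.mul_apply]
      simp only [Matrix.conjTranspose_apply, Quaternion.star_mul_self]
      exact map_sum (algebraMap ℝ ℍ[ℝ]) _ _
    exact (algebraMap ℝ ℍ[ℝ]).injective (hc.trans (map_zero _).symm)
  have := (Finset.sum_eq_zero_iff_of_nonneg
    (fun k _ => Quaternion.normSq_nonneg (a := B k j))).1 hs i (Finset.mem_univ i)
  exact Quaternion.normSq_eq_zero.1 this

theorem exists_inner_inverse (A : Matrix m n ℍ[ℝ]) : ∃ G : Matrix n m ℍ[ℝ], A * G * A = A := by
  classical
  let f : (m → ℍ[ℝ]) →ₗ[ℍ[ℝ]] (n → ℍ[ℝ]) := A.vecMulLinear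
  obtain ⟨s, hs⟩ := f.rangeRestrict.exists_rightInverse_of_surjective f.range_rangeRestrict
  obtain ⟨g, hg⟩ := LinearMap.exists_extend s
  have hfg : ∀ v, f (g (f v)) = f v := by
    intro v
    have h1 : g (f v) = s (f.rangeRestrict v) := LinearMap.congr_fun hg (f.rangeRestrict v)
    have h2 := LinearMap.congr_fun hs (f.rangeRestrict v)
    rw [h1]
    exact congrArg Subtype.val h2
  refine ⟨LinearMap.toMatrixRight' g, ?_⟩
  have hG : ∀ v, v ᵥ* (LinearMap.toMatrixRight' g) = g v := fun v =>
    LinearMap.congr_fun (LinearMap.toMatrixRight'.symm_apply_apply g) v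
  apply Matrix.ext_of_single_vecMul
  intro i
  rw [← Matrix.vecMul_vecMul, ← Matrix.vecMul_vecMul, hG]
  exact hfg _

theorem exists_one_three_inverse (A : Matrix m n ℍ[ℝ]) :
    ∃ Y : Matrix n m ℍ[ℝ], A * Y * A = A ∧ (A * Y)ᴴ = A * Y := by
  obtain ⟨G, hG⟩ := exists_inner_inverse (Aᴴ * A)
  have h : A * (G * Aᴴ) * A = A := by
    rw [← sub_eq_zero]
    have h0 : Aᴴ * (A * (G * Aᴴ) * A - A) = 0 := by
      rw [Matrix.mul_sub, sub_eq_zero]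
      simpa only [Matrix.mul_assoc] using hG
    have h1 : (A * (G * Aᴴ) * A - A)ᴴ = Aᴴ * A * Gᴴ * Aᴴ - Aᴴ := by
      simp [Matrix.conjTranspose_mul, Matrix.mul_assoc]
    apply eq_zero_of_conjTranspose_mul_self
    rw [h1, Matrix.sub_mul, Matrix.mul_assoc _ Aᴴ, h0, Matrix.mul_zero, sub_zero]
  refine ⟨G * Aᴴ, h, ?_⟩
  have h' : Aᴴ * (A * (G * Aᴴ))ᴴ = Aᴴ := by
    rw [← Matrix.conjTranspose_mul, h]
  have key : A * (G * Aᴴ) = A * (G * Aᴴ) * (A * (G * Aᴴ))ᴴ := by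
    conv_lhs => rw [← h']
    simp only [Matrix.mul_assoc]
  rw [key, Matrix.conjTranspose_mul, Matrix.conjTranspose_conjTranspose]

theorem exists_isMoorePenrose (A : Matrix m n ℍ[ℝ]) : ∃ X, IsMoorePenrose A X := by
  obtain ⟨Y, hY, hY'⟩ := exists_one_three_inverse A
  obtain ⟨Z, hZ, hZ'⟩ := exists_one_three_inverse Aᴴ
  have hW : A * Zᴴ * A = A := by
    have := congrArg Matrix.conjTranspose hZ
    simpa [Matrix.conjTranspose_mul, Matrix.mul_assoc] using this
  have hW' : (Zᴴ * A)ᴴ = Zᴴ * A := by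
    have := congrArg Matrix.conjTranspose hZ'
    simpa [Matrix.conjTranspose_mul] using this
  have e1 : A * (Zᴴ * A * Y) = A * Y := by rw [← Matrix.mul_assoc, ← Matrix.mul_assoc, hW]
  have e2 : Zᴴ * A * Y * A = Zᴴ * A := by
    rw [Matrix.mul_assoc, Matrix.mul_assoc, ← Matrix.mul_assoc A Y A, hY]
  refine ⟨Zᴴ * A * Y, ?_, ?_, ?_, ?_⟩
  · rw [e1, hY]
  · rw [e2, ← Matrix.mul_assoc, ← Matrix.mul_assoc, Matrix.mul_assoc Zᴴ A Zᴴ,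
      Matrix.mul_assoc Zᴴ _ A, hW]
  · rw [e1, hY']
  · rw [e2, hW']

/-- The Moore–Penrose inverse `A†`: the unique solution of the four Penrose equations. -/
def mpInv (A : Matrix m n ℍ[ℝ]) : Matrix n m ℍ[ℝ] :=
  Classical.choose (exists_isMoorePenrose A)

theorem mpInv_spec (A : Matrix m n ℍ[ℝ]) : IsMoorePenrose A (mpInv A) :=
  Classical.choose_spec (exists_isMoorePenrose A)

end MoorePenrose

scoped postfix:max "†" => mpInv

/-- The projector `L_A = I - A† A`. -/
def projL {m n : Type*} [Fintype m] [Fintype n] [DecidableEq n] (A : Matrix m n ℍ[ℝ]) :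
    Matrix n n ℍ[ℝ] := 1 - A† * A

/-- The projector `R_A = I - A A†`. -/
def projR {m n : Type*} [Fintype m] [Fintype n] [DecidableEq m] (A : Matrix m n ℍ[ℝ]) :
    Matrix m m ℍ[ℝ] := 1 - A * A†

/-! ### The system of four coupled equations -/

/-- The given coefficient matrices `A₁, …, A₄, B₁, …, B₄, C₁, …, C₄` of the system
```
A₁ X₁ - X₂ B₁ = C₁,  A₂ X₃ - X₂ B₂ = C₂,  A₃ X₄ - X₃ B₃ = C₃,  A₄ X₄ - X₅ B₄ = C₄
```
with arbitrary compatible sizes; the unknowns are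
`X₁ : a × k`, `X₂ : m × q`, `X₃ : p × l`, `X₄ : s × t`, `X₅ : u × v`. -/
structure Coeffs (m a k q p l s t u v : ℕ) where
  A₁ : Matrix (Fin m) (Fin a) ℍ[ℝ]
  B₁ : Matrix (Fin q) (Fin k) ℍ[ℝ]
  C₁ : Matrix (Fin m) (Fin k) ℍ[ℝ]
  A₂ : Matrix (Fin m) (Fin p) ℍ[ℝ]
  B₂ : Matrix (Fin q) (Fin l) ℍ[ℝ]
  C₂ : Matrix (Fin m) (Fin l) ℍ[ℝ]
  A₃ : Matrix (Fin p) (Fin s) ℍ[ℝ]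
  B₃ : Matrix (Fin l) (Fin t) ℍ[ℝ]
  C₃ : Matrix (Fin p) (Fin t) ℍ[ℝ]
  A₄ : Matrix (Fin u) (Fin s) ℍ[ℝ]
  B₄ : Matrix (Fin v) (Fin t) ℍ[ℝ]
  C₄ : Matrix (Fin u) (Fin t) ℍ[ℝ]

/-- The free matrices `W₄, W₅, W₆, T₁, T₂, T₃, Z₁, …, Z₈` of the general solution. -/
structure Params (m a k q p l s t u v : ℕ) where
  W₄ : Matrix (Fin a) (Fin q) ℍ[ℝ]
  W₅ : Matrix (Fin m) (Fin q) ℍ[ℝ]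
  W₆ : Matrix (Fin a) (Fin k) ℍ[ℝ]
  T₁ : Matrix (Fin s) (Fin v) ℍ[ℝ]
  T₂ : Matrix (Fin s) (Fin t) ℍ[ℝ]
  T₃ : Matrix (Fin u) (Fin v) ℍ[ℝ]
  Z₁ : Matrix (Fin s) (Fin l) ℍ[ℝ]
  Z₂ : Matrix (Fin p) (Fin q) ℍ[ℝ]
  Z₃ : Matrix (Fin p) (Fin q) ℍ[ℝ]
  Z₄ : Matrix (Fin s) (Fin l) ℍ[ℝ]
  Z₅ : Matrix (Fin s) (Fin l) ℍ[ℝ]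
  Z₆ : Matrix (Fin p ⊕ Fin s) (Fin l) ℍ[ℝ]
  Z₇ : Matrix (Fin p) (Fin q ⊕ Fin l) ℍ[ℝ]
  Z₈ : Matrix (Fin p) (Fin q ⊕ Fin l) ℍ[ℝ]

namespace Coeffs

variable {m a k q p l s t u v : ℕ} (c : Coeffs m a k q p l s t u v)

/-- `(X₁, …, X₅)` solves the system. -/
def IsSolution (X₁ : Matrix (Fin a) (Fin k) ℍ[ℝ]) (X₂ : Matrix (Fin m) (Fin q) ℍ[ℝ])
    (X₃ : Matrix (Fin p) (Fin l) ℍ[ℝ]) (X₄ : Matrix (Fin s) (Fin t) ℍ[ℝ])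
    (X₅ : Matrix (Fin u) (Fin v) ℍ[ℝ]) : Prop :=
  c.A₁ * X₁ - X₂ * c.B₁ = c.C₁ ∧
  c.A₂ * X₃ - X₂ * c.B₂ = c.C₂ ∧
  c.A₃ * X₄ - X₃ * c.B₃ = c.C₃ ∧
  c.A₄ * X₄ - X₅ * c.B₄ = c.C₄

/-- The system has a solution. -/
def Consistent : Prop :=
  ∃ X₁ X₂ X₃ X₄ X₅, c.IsSolution X₁ X₂ X₃ X₄ X₅

/-- The ten rank equalities.  `Matrix.fromCols` puts blocks side by side, `Matrix.fromRows`
stacks them. -/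
def RankConditions : Prop :=
  rk (.fromBlocks c.C₁ c.A₁ c.B₁ 0) = rk c.A₁ + rk c.B₁ ∧
  rk (.fromBlocks c.C₂ c.A₂ c.B₂ 0) = rk c.A₂ + rk c.B₂ ∧
  rk (.fromBlocks c.C₃ c.A₃ c.B₃ 0) = rk c.A₃ + rk c.B₃ ∧
  rk (.fromBlocks c.C₄ c.A₄ c.B₄ 0) = rk c.A₄ + rk c.B₄ ∧
  rk (.fromBlocks (.fromCols c.C₁ c.C₂) (.fromCols c.A₁ c.A₂)
      (.fromCols c.B₁ c.B₂) 0) =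
    rk (.fromCols c.A₁ c.A₂) + rk (.fromCols c.B₁ c.B₂) ∧
  rk (.fromBlocks (.fromRows c.C₃ c.C₄) (.fromRows c.A₃ c.A₄)
      (.fromRows c.B₃ c.B₄) 0) =
    rk (.fromRows c.A₃ c.A₄) + rk (.fromRows c.B₃ c.B₄) ∧
  rk (.fromBlocks (.fromCols c.C₁ (c.A₂ * c.C₃ + c.C₂ * c.B₃)) (.fromCols c.A₁ (c.A₂ * c.A₃))
      (.fromCols c.B₁ (c.B₂ * c.B₃)) 0) =
    rk (.fromCols c.A₁ (c.A₂ * c.A₃)) + rk (.fromCols c.B₁ (c.B₂ * c.B₃)) ∧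
  rk (.fromBlocks (.fromRows (c.A₂ * c.C₃ + c.C₂ * c.B₃) c.C₄) (.fromRows (c.A₂ * c.A₃) c.A₄)
      (.fromRows (c.B₂ * c.B₃) c.B₄) 0) =
    rk (.fromRows (c.A₂ * c.A₃) c.A₄) + rk (.fromRows (c.B₂ * c.B₃) c.B₄) ∧
  rk (.fromBlocks (c.A₂ * c.C₃ + c.C₂ * c.B₃) (c.A₂ * c.A₃) (c.B₂ * c.B₃) 0) =
    rk (c.A₂ * c.A₃) + rk (c.B₂ * c.B₃) ∧
  rk (.fromBlocks (.fromBlocks c.C₁ (c.A₂ * c.C₃ + c.C₂ * c.B₃) 0 c.C₄)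
      (.fromBlocks c.A₁ (c.A₂ * c.A₃) 0 c.A₄)
      (.fromBlocks c.B₁ (c.B₂ * c.B₃) 0 c.B₄) 0) =
    rk (.fromBlocks c.A₁ (c.A₂ * c.A₃) 0 c.A₄) + rk (.fromBlocks c.B₁ (c.B₂ * c.B₃) 0 c.B₄)

/-! #### Auxiliary matrices -/

def A₁₁ := projR c.B₂ * c.B₁

def B₁₁ := projR c.A₁ * c.A₂

def C₁₁ := c.B₁ * projL c.A₁₁

def D₁₁ := projR c.A₁ * (projR c.A₂ * c.C₂ * c.B₂† * c.B₁ - c.C₁) * projL c.A₁₁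

def A₂₂ := projR (c.A₄ * projL c.A₃) * c.A₄

def B₂₂ := c.B₃ * projL c.B₄

def C₂₂ := projR (c.A₄ * projL c.A₃) * (c.C₄ - c.A₄ * c.A₃† * c.C₃) * projL c.B₄

def A₃₃ : Matrix (Fin p) (Fin p ⊕ Fin s) ℍ[ℝ] :=
  .fromCols (projL c.A₂) (-(c.A₃ * projL c.A₂₂))

def B₃₃ : Matrix (Fin q ⊕ Fin l) (Fin l) ℍ[ℝ] :=
  .fromRows (projR c.C₁₁ * c.B₂) (-projR c.B₃)

def E₁ := -(projR c.A₃ * c.C₃ * c.B₃†) + c.A₃ * c.A₂₂† * c.C₂₂ * c.B₂₂† - c.A₂† * c.C₂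
  - c.B₁₁† * c.D₁₁ * c.C₁₁† * c.B₂

def A := projR c.A₃₃ * projL c.B₁₁

def B := c.B₂ * projL c.B₃₃

def C := -(projR c.A₃₃ * c.A₃)

def D := projR c.B₂₂ * projL c.B₃₃

def E := projR c.A₃₃ * c.E₁ * projL c.B₃₃

def M := projR c.A * c.C

def N := c.D * projL c.B

def S := c.C * projL c.M

/-- The solvability conditions in terms of projectors. -/
def ProjectorConditions : Prop :=
  (projR c.A₂ * c.C₂ * projL c.B₂ = 0 ∧ c.D₁₁ * projL c.C₁₁ = 0 ∧ projR c.B₁₁ * c.D₁₁ = 0) ∧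
  (projR c.A₃ * c.C₃ * projL c.B₃ = 0 ∧ projR c.A₂₂ * c.C₂₂ = 0 ∧ c.C₂₂ * projL c.B₂₂ = 0) ∧
  (projR c.M * projR c.A * c.E = 0 ∧ c.E * projL c.B * projL c.N = 0 ∧
    projR c.A * c.E * projL c.D = 0 ∧ projR c.C * c.E * projL c.B = 0)

/-! #### The general solution as a function of the free matrices -/

variable (P : Params m a k q p l s t u v)

def W₂ := c.A† * c.E * c.B† - c.A† * c.C * c.M† * c.E * c.B†
  - c.A† * c.S * c.C† * c.E * c.N† * c.D * c.B†
  - c.A† * c.S * P.Z₁ * projR c.N * c.D * c.B†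
  + projL c.A * P.Z₂ + P.Z₃ * projR c.B

def T₅ := c.M† * c.E * c.D† + c.S† * c.S * c.C† * c.E * c.N†
  + projL c.M * projL c.S * P.Z₄ + projL c.M * P.Z₁ * projR c.N + P.Z₅ * projR c.D

/-- The block matrix whose upper and lower blocks are `W₁` and `T₄`. -/
def colBlock := c.A₃₃† * (c.E₁ - projL c.B₁₁ * c.W₂ P * c.B₂ + c.A₃ * c.T₅ P * projR c.B₂₂)
  - c.A₃₃† * P.Z₇ * c.B₃₃ + projL c.A₃₃ * P.Z₆

/-- The block matrix whose left and right blocks are `W₃` and `T₆`. -/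
def rowBlock := projR c.A₃₃ *
    (c.E₁ - projL c.B₁₁ * c.W₂ P * c.B₂ + c.A₃ * c.T₅ P * projR c.B₂₂) * c.B₃₃†
  + c.A₃₃ * c.A₃₃† * P.Z₇ + P.Z₈ * projR c.B₃₃

def W₁ : Matrix (Fin p) (Fin l) ℍ[ℝ] := Matrix.fromCols 1 0 * c.colBlock P

def T₄ : Matrix (Fin s) (Fin l) ℍ[ℝ] := Matrix.fromCols 0 1 * c.colBlock P

def W₃ : Matrix (Fin p) (Fin q) ℍ[ℝ] := c.rowBlock P * Matrix.fromRows 1 0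

def T₆ : Matrix (Fin p) (Fin l) ℍ[ℝ] := c.rowBlock P * Matrix.fromRows 0 1

def U₁ := c.B₁₁† * c.D₁₁ * c.C₁₁† + projL c.B₁₁ * c.W₂ P + c.W₃ P * projR c.C₁₁

def V₁ := -(projR c.A₁ * (c.C₁ - projR c.A₂ * c.C₂ * c.B₂† * c.B₁ + c.A₂ * c.U₁ P * c.B₁)
    * c.A₁₁†) + c.A₁ * P.W₄ + P.W₅ * projR c.A₁₁

def V₂ := c.A₂₂† * c.C₂₂ * c.B₂₂† + projL c.A₂₂ * c.T₄ P + c.T₅ P * projR c.B₂₂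

def U₂ := (c.A₄ * projL c.A₃)† * (c.C₄ - c.A₄ * c.A₃† * c.C₃ - c.A₄ * c.V₂ P * c.B₃)
  + P.T₁ * c.B₄ + projL (c.A₄ * projL c.A₃) * P.T₂

def solX₁ := c.A₁† * (c.C₁ - projR c.A₂ * c.C₂ * c.B₂† * c.B₁ + c.A₂ * c.U₁ P * c.B₁)
  + P.W₄ * c.A₁₁ + projL c.A₁ * P.W₆

def solX₂ := -(projR c.A₂ * c.C₂ * c.B₂†) + c.A₂ * c.U₁ P + c.V₁ P * projR c.B₂

/-- The first expression for `X₃`. -/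
def solX₃ := c.A₂† * c.C₂ + c.U₁ P * c.B₂ + projL c.A₂ * c.W₁ P

/-- The second expression for `X₃`. -/
def solX₃' := -(projR c.A₃ * c.C₃ * c.B₃†) + c.A₃ * c.V₂ P + c.T₆ P * projR c.B₃

def solX₄ := c.A₃† * c.C₃ + c.V₂ P * c.B₃ + projL c.A₃ * c.U₂ P

def solX₅ := -(projR (c.A₄ * projL c.A₃)
    * (c.C₄ - c.A₄ * c.A₃† * c.C₃ - c.A₄ * c.V₂ P * c.B₃) * c.B₄†)
  + c.A₄ * projL c.A₃ * P.T₁ + P.T₃ * projR c.B₄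

end Coeffs

end QuatSylvester

end

set_option linter.unusedSectionVars false

namespace QuatSylvester

/-! ### Penrose identities and annihilation rules for the projectors -/

section Penrose

variable {m n k l : Type*} [Fintype m] [Fintype n] [Fintype k] [Fintype l]

/-! The system is a chain: equations 1 and 2 share X₂, equations 2 and 3 share X₃, equations 3 and 4
share X₄. A Sylvester equation AX − YB = C is solvable iff R_A C L_B = 0, and its solutions are
explicit. Solving equations 2 and 3 this way and substituting into 1 and 4 leaves two Sylvester
equations, whose solvability reads B₁₁U₁C₁₁ = D₁₁ and A₂₂V₂B₂₂ = C₂₂; these give the first six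
projector conditions, two of them being those of equations 2 and 3 themselves.

X₃ now has two expressions. Equating them gives an equation A₃₃X + YB₃₃ = G for the blocks X = (W₁;
T₄) and Y = (W₃, T₆), with G depending on W₂ and T₅. Its solvability is A W₂ B + C T₅ D = E, which
yields the last four conditions. Each equation type has a necessary condition, a family of solutions
under that condition, and a proof that the family is exhaustive (`sylvester_param`, `mul_mul_param`,
`mul_add_mul_param`, `two_term_param`). Composing them gives (1) ⇔ (3) and the general solution.

For the ranks, `rk_fromBlocks_eq_iff` turns each equality into R_A C L_B = 0 for block matrices.
Then (1) ⇒ (2) follows by assembling the equations, after eliminating X₃, into Sylvester equations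
with block diagonal unknowns. For (2) ⇒ (3), the first six conditions solve the two halves of the
chain separately; E₁ is the gap between the two resulting values of X₃, and the four rank equalities
containing F annihilate that gap between suitable factors P and Q. -/

theorem mul_mpInv_mul (A : Matrix m n ℍ[ℝ]) : A * (A† * A) = A := by
  rw [← Matrix.mul_assoc, (mpInv_spec A).mul_mul_self]

theorem mul_mpInv_mul_assoc {o : Type*} (A : Matrix m n ℍ[ℝ]) (X : Matrix n o ℍ[ℝ]) :
    A * (A† * (A * X)) = A * X := by
  rw [← Matrix.mul_assoc, ← Matrix.mul_assoc, (mpInv_spec A).mul_mul_self]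

theorem mul_projL [DecidableEq n] (A : Matrix m n ℍ[ℝ]) : A * projL A = 0 := by
  rw [projL, Matrix.mul_sub, mul_mpInv_mul, Matrix.mul_one, sub_self]

theorem projR_mul [DecidableEq m] (A : Matrix m n ℍ[ℝ]) : projR A * A = 0 := by
  rw [projR, Matrix.sub_mul, Matrix.mul_assoc, mul_mpInv_mul, Matrix.one_mul, sub_self]

theorem mul_projL_assoc [DecidableEq n] {o : Type*} (A : Matrix m n ℍ[ℝ]) (X : Matrix n o ℍ[ℝ]) :
    A * (projL A * X) = 0 := by
  rw [← Matrix.mul_assoc, mul_projL, Matrix.zero_mul]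

theorem projR_mul_assoc [DecidableEq m] {o : Type*} (A : Matrix m n ℍ[ℝ]) (X : Matrix n o ℍ[ℝ]) :
    projR A * (A * X) = 0 := by
  rw [← Matrix.mul_assoc, projR_mul, Matrix.zero_mul]

/-- A matrix killed on the left by `R_A` factors through `A`. -/
theorem mul_mpInv_mul_of_projR_mul [DecidableEq m] {o : Type*} {A : Matrix m n ℍ[ℝ]} {X : Matrix m o ℍ[ℝ]}
    (h : projR A * X = 0) : A * (A† * X) = X := by
  rw [projR, Matrix.sub_mul, Matrix.one_mul, sub_eq_zero, Matrix.mul_assoc] at h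
  exact h.symm

theorem mul_mpInv_mul_of_mul_projL [DecidableEq n] {o : Type*} {A : Matrix m n ℍ[ℝ]} {X : Matrix o n ℍ[ℝ]}
    (h : X * projL A = 0) : X * (A† * A) = X := by
  rw [projL, Matrix.mul_sub, Matrix.mul_one, sub_eq_zero] at h
  exact h.symm

theorem mul_projR_of_mul [DecidableEq m] {o : Type*} {A : Matrix m n ℍ[ℝ]} {X : Matrix o m ℍ[ℝ]}
    (h : X * A = 0) : X * projR A = X := by
  rw [projR, Matrix.mul_sub, Matrix.mul_one, ← Matrix.mul_assoc, h, Matrix.zero_mul, sub_zero]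

theorem projL_mul_of_mul [DecidableEq n] {o : Type*} {A : Matrix m n ℍ[ℝ]} {X : Matrix n o ℍ[ℝ]}
    (h : A * X = 0) : projL A * X = X := by
  rw [projL, Matrix.sub_mul, Matrix.one_mul, Matrix.mul_assoc, h, Matrix.mul_zero, sub_zero]

/-- If `A` is unchanged by a Hermitian factor on its right, then so is `A†` on its left. -/
theorem mul_mpInv_of_mul {A : Matrix m n ℍ[ℝ]} {Q : Matrix n n ℍ[ℝ]} (hQ : Qᴴ = Q)
    (h : A * Q = A) : Q * A† = A† := by
  have h1 : A† * A * Q = A† * A := by rw [Matrix.mul_assoc, h]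
  have h2 := congrArg Matrix.conjTranspose h1
  rw [Matrix.conjTranspose_mul, hQ, (mpInv_spec A).right_herm] at h2
  calc Q * A† = Q * (A† * A * A†) := by rw [(mpInv_spec A).self_mul_mul]
    _ = A† := by rw [← Matrix.mul_assoc Q, h2, (mpInv_spec A).self_mul_mul]

theorem mpInv_mul_of_mul {A : Matrix m n ℍ[ℝ]} {Q : Matrix m m ℍ[ℝ]} (hQ : Qᴴ = Q)
    (h : Q * A = A) : A† * Q = A† := by
  have h1 : Q * (A * A†) = A * A† := by rw [← Matrix.mul_assoc, h]
  have h2 := congrArg Matrix.conjTranspose h1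
  rw [Matrix.conjTranspose_mul, hQ, (mpInv_spec A).left_herm] at h2
  calc A† * Q = A† * A * A† * Q := by rw [(mpInv_spec A).self_mul_mul]
    _ = A† * (A * A† * Q) := by simp only [Matrix.mul_assoc]
    _ = A† := by rw [h2, ← Matrix.mul_assoc, (mpInv_spec A).self_mul_mul]

theorem conjTranspose_projL [DecidableEq n] (A : Matrix m n ℍ[ℝ]) : (projL A)ᴴ = projL A := by
  rw [projL, Matrix.conjTranspose_sub, (mpInv_spec A).right_herm, Matrix.conjTranspose_one]

theorem conjTranspose_projR [DecidableEq m] (A : Matrix m n ℍ[ℝ]) : (projR A)ᴴ = projR A := by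
  rw [projR, Matrix.conjTranspose_sub, (mpInv_spec A).left_herm, Matrix.conjTranspose_one]

theorem projL_mul_projL [DecidableEq n] (A : Matrix m n ℍ[ℝ]) : projL A * projL A = projL A :=
  projL_mul_of_mul (mul_projL A)

theorem projR_mul_projR [DecidableEq m] (A : Matrix m n ℍ[ℝ]) : projR A * projR A = projR A :=
  mul_projR_of_mul (projR_mul A)

end Penrose

/-! ### One-step matrix equations: solvability and all solutions -/

section Equations

variable {m n k l : Type*} [Fintype m] [Fintype n] [Fintype k] [Fintype l]
  [DecidableEq m] [DecidableEq n] [DecidableEq k] [DecidableEq l]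

/-- The generalized Sylvester equation, necessity. -/
theorem sylvester_cond {A : Matrix m n ℍ[ℝ]} {B : Matrix k l ℍ[ℝ]} {C : Matrix m l ℍ[ℝ]}
    {X : Matrix n l ℍ[ℝ]} {Y : Matrix m k ℍ[ℝ]} (h : A * X - Y * B = C) :
    projR A * C * projL B = 0 := by
  rw [← h, Matrix.mul_sub, Matrix.sub_mul, projR_mul_assoc, Matrix.mul_assoc (projR A),
    Matrix.mul_assoc Y, mul_projL]
  simp

theorem sylvester_solution {A : Matrix m n ℍ[ℝ]} {B : Matrix k l ℍ[ℝ]} {C : Matrix m l ℍ[ℝ]}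
    (h : projR A * C * projL B = 0) (U : Matrix n k ℍ[ℝ]) (V : Matrix m k ℍ[ℝ])
    (W : Matrix n l ℍ[ℝ]) :
    A * (A† * C + U * B + projL A * W) - (-(projR A * C * B†) + A * U + V * projR B) * B = C := by
  have h1 := mul_mpInv_mul_of_mul_projL h
  have h2 : projR A * C = C - A * (A† * C) := by
    rw [projR, Matrix.sub_mul, Matrix.one_mul, Matrix.mul_assoc]
  simp only [Matrix.mul_add, Matrix.add_mul, Matrix.neg_mul, Matrix.mul_assoc, mul_projL_assoc,
    projR_mul, Matrix.mul_zero] at h1 ⊢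
  rw [h1, h2]
  abel

/-- The parameters are read off the solution itself: after C is replaced by AX − YB, the choice U =
A†Y, V = R_A Y, W = X makes the formula reproduce X and Y identically. The other one-step equations
are treated in the same way. -/
theorem sylvester_param {A : Matrix m n ℍ[ℝ]} {B : Matrix k l ℍ[ℝ]} {C : Matrix m l ℍ[ℝ]}
    {X : Matrix n l ℍ[ℝ]} {Y : Matrix m k ℍ[ℝ]} (h : A * X - Y * B = C) :
    ∃ (U : Matrix n k ℍ[ℝ]) (V : Matrix m k ℍ[ℝ]) (W : Matrix n l ℍ[ℝ]),
      X = A† * C + U * B + projL A * W ∧ Y = -(projR A * C * B†) + A * U + V * projR B := by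
  refine ⟨A† * Y, projR A * Y, X, ?_, ?_⟩
  · rw [← h, projL, Matrix.mul_sub, Matrix.sub_mul, Matrix.one_mul]
    simp only [Matrix.mul_assoc]
    abel
  · rw [← h, Matrix.mul_sub, projR_mul_assoc, projR, projR]
    simp only [Matrix.mul_sub, Matrix.sub_mul, Matrix.one_mul, Matrix.mul_one, Matrix.mul_assoc,
      Matrix.neg_mul, zero_sub]
    abel

/-- The equation `A X B = C`. -/
theorem mul_mul_cond {A : Matrix m n ℍ[ℝ]} {B : Matrix k l ℍ[ℝ]} {C : Matrix m l ℍ[ℝ]}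
    {X : Matrix n k ℍ[ℝ]} (h : A * X * B = C) : projR A * C = 0 ∧ C * projL B = 0 := by
  subst h
  simp [Matrix.mul_assoc, projR_mul_assoc, mul_projL]

theorem mul_mul_solution {A : Matrix m n ℍ[ℝ]} {B : Matrix k l ℍ[ℝ]} {C : Matrix m l ℍ[ℝ]}
    (h : projR A * C = 0) (h' : C * projL B = 0) (W Z : Matrix n k ℍ[ℝ]) :
    A * (A† * C * B† + projL A * W + Z * projR B) * B = C := by
  have h1 := mul_mpInv_mul_of_projR_mul h
  have h2 := mul_mpInv_mul_of_mul_projL h'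
  simp only [Matrix.mul_add, Matrix.add_mul, Matrix.mul_assoc, mul_projL_assoc, projR_mul,
    Matrix.mul_zero, add_zero, h2, h1]

theorem mul_mul_param {A : Matrix m n ℍ[ℝ]} {B : Matrix k l ℍ[ℝ]} {C : Matrix m l ℍ[ℝ]}
    {X : Matrix n k ℍ[ℝ]} (h : A * X * B = C) :
    ∃ W Z : Matrix n k ℍ[ℝ], X = A† * C * B† + projL A * W + Z * projR B := by
  refine ⟨X, A† * A * X, ?_⟩
  rw [← h, projL, projR]
  simp only [Matrix.mul_sub, Matrix.sub_mul, Matrix.one_mul, Matrix.mul_one, Matrix.mul_assoc]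
  abel

/-- The equation `A X + Y B = C`. -/
theorem mul_add_mul_cond {A : Matrix m n ℍ[ℝ]} {B : Matrix k l ℍ[ℝ]} {C : Matrix m l ℍ[ℝ]}
    {X : Matrix n l ℍ[ℝ]} {Y : Matrix m k ℍ[ℝ]} (h : A * X + Y * B = C) :
    projR A * C * projL B = 0 :=
  sylvester_cond (X := X) (Y := -Y) (by rw [← h, Matrix.neg_mul, sub_neg_eq_add])

theorem mul_add_mul_solution {A : Matrix m n ℍ[ℝ]} {B : Matrix k l ℍ[ℝ]} {C : Matrix m l ℍ[ℝ]}
    (h : projR A * C * projL B = 0) (U V : Matrix m k ℍ[ℝ]) (W : Matrix n l ℍ[ℝ]) :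
    A * (A† * C - A† * U * B + projL A * W)
      + (projR A * C * B† + A * A† * U + V * projR B) * B = C := by
  have h1 := mul_mpInv_mul_of_mul_projL h
  have h2 : projR A * C = C - A * (A† * C) := by
    rw [projR, Matrix.sub_mul, Matrix.one_mul, Matrix.mul_assoc]
  simp only [Matrix.mul_add, Matrix.mul_sub, Matrix.add_mul, Matrix.mul_assoc, mul_projL_assoc,
    projR_mul, Matrix.mul_zero] at h1 ⊢
  rw [h1, h2]
  abel

theorem mul_add_mul_param {A : Matrix m n ℍ[ℝ]} {B : Matrix k l ℍ[ℝ]} {C : Matrix m l ℍ[ℝ]}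
    {X : Matrix n l ℍ[ℝ]} {Y : Matrix m k ℍ[ℝ]} (h : A * X + Y * B = C) :
    ∃ (U V : Matrix m k ℍ[ℝ]) (W : Matrix n l ℍ[ℝ]),
      X = A† * C - A† * U * B + projL A * W ∧
      Y = projR A * C * B† + A * A† * U + V * projR B := by
  refine ⟨Y, projR A * Y, X, ?_, ?_⟩
  · rw [← h, projL, Matrix.mul_add, Matrix.sub_mul, Matrix.one_mul]
    simp only [Matrix.mul_assoc]
    abel
  · rw [← h, Matrix.mul_add, projR_mul_assoc, projR, projR]
    simp only [Matrix.mul_sub, Matrix.sub_mul, Matrix.one_mul, Matrix.mul_one, Matrix.mul_assoc,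
      zero_add]
    abel

end Equations

/-! ### The equation A X B + C Y D = E -/

section TwoTerm

variable {m n k l i j : Type*} [Fintype m] [Fintype n] [Fintype k] [Fintype l] [Fintype i]
  [Fintype j] [DecidableEq m] [DecidableEq n] [DecidableEq k] [DecidableEq l] [DecidableEq i]
  [DecidableEq j]
  {A : Matrix m n ℍ[ℝ]} {B : Matrix k l ℍ[ℝ]} {C : Matrix m i ℍ[ℝ]} {D : Matrix j l ℍ[ℝ]}
  {E : Matrix m l ℍ[ℝ]} {M : Matrix m i ℍ[ℝ]} {N : Matrix j l ℍ[ℝ]} {S : Matrix m i ℍ[ℝ]}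

/-- The equation `A X B + C Y D = E`, necessity. -/
theorem two_term_cond (hM : M = projR A * C) (hN : N = D * projL B)
    {X : Matrix n k ℍ[ℝ]} {Y : Matrix i j ℍ[ℝ]} (h : A * X * B + C * Y * D = E) :
    projR M * projR A * E = 0 ∧ E * projL B * projL N = 0 ∧
      projR A * E * projL D = 0 ∧ projR C * E * projL B = 0 := by
  have h1 : projR M * (projR A * (C * (Y * D))) = 0 := by
    rw [← Matrix.mul_assoc (projR A), ← hM, projR_mul_assoc]
  have h2 : D * (projL B * projL N) = 0 := by
    rw [← Matrix.mul_assoc, ← hN, mul_projL]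
  subst h
  simp only [Matrix.mul_assoc, Matrix.mul_add, Matrix.add_mul, projR_mul_assoc,
    mul_projL, Matrix.mul_zero, h1, h2, add_zero,
    Matrix.zero_mul, and_self]

/-- Once Y is fixed, X only has to solve AXB = E − CYD, so the right side must be killed by R_A on
the left and by L_B on the right. The term M†ED† in Y secures the first; the term with C†EN† secures
the second without disturbing the first, because R_A S = M L_M = 0. -/
theorem two_term_solution (hM : M = projR A * C) (hN : N = D * projL B) (hS : S = C * projL M)
    (h1 : projR M * projR A * E = 0) (h2 : E * projL B * projL N = 0)
    (h3 : projR A * E * projL D = 0) (h4 : projR C * E * projL B = 0)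
    (Z₁ Z₄ Z₅ : Matrix i j ℍ[ℝ]) (Z₂ Z₃ : Matrix n k ℍ[ℝ]) :
    A * (A† * E * B† - A† * C * M† * E * B† - A† * S * C† * E * N† * D * B†
        - A† * S * Z₁ * projR N * D * B† + projL A * Z₂ + Z₃ * projR B) * B
      + C * (M† * E * D† + S† * S * C† * E * N† + projL M * projL S * Z₄
        + projL M * Z₁ * projR N + Z₅ * projR D) * D = E := by
  have hMA : M† * projR A = M† :=
    mpInv_mul_of_mul (conjTranspose_projR A) (by rw [hM, ← Matrix.mul_assoc, projR_mul_projR])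
  have hNB : projL B * N† = N† :=
    mul_mpInv_of_mul (conjTranspose_projL B) (by rw [hN, Matrix.mul_assoc, projL_mul_projL])
  have hSM : projL M * S† = S† :=
    mul_mpInv_of_mul (conjTranspose_projL M) (by rw [hS, Matrix.mul_assoc, projL_mul_projL])
  have hCS (X : Matrix i l ℍ[ℝ]) : C * (S† * (S * X)) = S * X := by
    rw [← hSM, Matrix.mul_assoc, ← Matrix.mul_assoc C, ← hS, mul_mpInv_mul_assoc]
  have hCL (X : Matrix i l ℍ[ℝ]) : C * (projL M * X) = S * X := by
    rw [← Matrix.mul_assoc, ← hS]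
  have hSL (X : Matrix i l ℍ[ℝ]) : S * (projL S * X) = 0 := mul_projL_assoc S X
  have hMD : M† * (E * (D† * D)) = M† * E := by
    rw [← hMA, ← Matrix.mul_assoc, Matrix.mul_assoc _ _ E]
    have := mul_mpInv_mul_of_mul_projL h3
    rw [Matrix.mul_assoc, this]
  have hK : C * (M† * E * D† + S† * S * C† * E * N† + projL M * projL S * Z₄
        + projL M * Z₁ * projR N + Z₅ * projR D) * D
      = C * (M† * E) + S * (C† * (E * (N† * D))) + S * (Z₁ * (projR N * D)) := by
    simp only [Matrix.mul_add, Matrix.add_mul, Matrix.mul_assoc, projR_mul, Matrix.mul_zero,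
      hCS, hCL, hMD, hSL, add_zero]
  -- By `hK` this is E − CYD, the right side left for X.
  set H := E - C * (M† * E) - S * (C† * (E * (N† * D))) - S * (Z₁ * (projR N * D)) with hH
  have hX : A * (A† * E * B† - A† * C * M† * E * B† - A† * S * C† * E * N† * D * B†
        - A† * S * Z₁ * projR N * D * B† + projL A * Z₂ + Z₃ * projR B) * B
      = A * (A† * H * B† + projL A * Z₂ + Z₃ * projR B) * B := by
    simp only [hH, Matrix.mul_sub, Matrix.sub_mul, Matrix.mul_assoc]
  have hRS (X : Matrix i l ℍ[ℝ]) : projR A * (S * X) = 0 := by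
    rw [hS, ← Matrix.mul_assoc, ← Matrix.mul_assoc, ← hM, mul_projL, Matrix.zero_mul]
  have hRH : projR A * H = 0 := by
    have h5 : M * (M† * (projR A * E)) = projR A * E :=
      mul_mpInv_mul_of_projR_mul (by rw [← Matrix.mul_assoc, h1])
    rw [← Matrix.mul_assoc M†, hMA] at h5
    rw [hH]
    simp only [Matrix.mul_sub, hRS, sub_zero]
    rw [← Matrix.mul_assoc, ← hM, h5, sub_self]
  have hHL : H * projL B = 0 := by
    have h5 : E * (N† * (D * projL B)) = E * projL B := by
      rw [← hN, ← hNB, Matrix.mul_assoc, ← Matrix.mul_assoc]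
      exact mul_mpInv_mul_of_mul_projL h2
    have h6 : projR N * (D * projL B) = 0 := by rw [← hN, projR_mul]
    have h7 : C * (C† * (E * projL B)) = E * projL B :=
      mul_mpInv_mul_of_projR_mul (by rw [← Matrix.mul_assoc, h4])
    have h8 : S * (C† * (E * projL B)) = E * projL B - C * (M† * (E * projL B)) := by
      rw [hS, projL, Matrix.mul_sub, Matrix.sub_mul, Matrix.mul_one, h7, ← hMA]
      simp only [Matrix.mul_assoc]
      nth_rw 2 [hM]
      rw [Matrix.mul_assoc (projR A) C, h7, ← Matrix.mul_assoc (projR A) (projR A),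
        projR_mul_projR]
    rw [hH]
    simp only [Matrix.sub_mul, Matrix.mul_assoc, h5, h6, h8, Matrix.mul_zero]
    abel
  rw [hX, mul_mul_solution hRH hHL, hK, hH]
  abel

/-- Subtracting the particular solution with all parameters zero reduces the claim to the
homogeneous equation. -/
theorem two_term_param (hM : M = projR A * C) (hN : N = D * projL B) (hS : S = C * projL M)
    {X : Matrix n k ℍ[ℝ]} {Y : Matrix i j ℍ[ℝ]} (h : A * X * B + C * Y * D = E) :
    ∃ (Z₁ Z₄ Z₅ : Matrix i j ℍ[ℝ]) (Z₂ Z₃ : Matrix n k ℍ[ℝ]),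
      X = A† * E * B† - A† * C * M† * E * B† - A† * S * C† * E * N† * D * B†
        - A† * S * Z₁ * projR N * D * B† + projL A * Z₂ + Z₃ * projR B ∧
      Y = M† * E * D† + S† * S * C† * E * N† + projL M * projL S * Z₄
        + projL M * Z₁ * projR N + Z₅ * projR D := by
  obtain ⟨h1, h2, h3, h4⟩ := two_term_cond hM hN h
  have h0 := two_term_solution hM hN hS h1 h2 h3 h4 0 0 0 0 0
  simp only [Matrix.mul_zero, Matrix.zero_mul, add_zero, sub_zero] at h0
  set X₀ := A† * E * B† - A† * C * M† * E * B† - A† * S * C† * E * N† * D * B† with hX₀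
  set Y₀ := M† * E * D† + S† * S * C† * E * N† with hY₀
  set y := Y - Y₀ with hy
  have hhom : A * ((X - X₀) * B) + C * (y * D) = 0 := by
    rw [hy]
    simp only [Matrix.mul_sub, Matrix.sub_mul]
    simp only [← Matrix.mul_assoc]
    rw [sub_add_sub_comm, h, h0, sub_self]
  -- This keeps yD but upgrades M y D = 0 to M y' = 0; hence C y' = S y', and y' can be fed to the
  -- parameters behind L_M.
  set y' := y * (D * D†) with hy'
  have hy'D : y' * D = y * D := by
    rw [hy', Matrix.mul_assoc, Matrix.mul_assoc, mul_mpInv_mul]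
  have hMy' : M * y' = 0 := by
    have : projR A * (C * (y * D)) = 0 := by
      have := congrArg (projR A * ·) hhom
      simpa only [Matrix.mul_add, projR_mul_assoc, zero_add, Matrix.mul_zero] using this
    rw [hy', hM, ← Matrix.mul_assoc y, ← Matrix.mul_assoc (_ * C), Matrix.mul_assoc (projR A),
      this, Matrix.zero_mul]
  have hCy'N : C * y' * N = 0 := by
    have := congrArg (· * projL B) hhom
    simp only [Matrix.add_mul, Matrix.mul_assoc, mul_projL, Matrix.mul_zero, zero_add,
      Matrix.zero_mul] at this
    rw [hN, ← Matrix.mul_assoc, Matrix.mul_assoc C, hy'D]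
    simpa only [Matrix.mul_assoc] using this
  have hCS : S * y' = C * y' := by rw [hS, Matrix.mul_assoc, projL_mul_of_mul hMy']
  have hSN : S * y' * projR N = C * y' := by rw [hCS, mul_projR_of_mul hCy'N]
  have hSM : projL M * S† = S† :=
    mul_mpInv_of_mul (conjTranspose_projL M) (by rw [hS, Matrix.mul_assoc, projL_mul_projL])
  -- The Z₁ and Z₄ terms of Y contribute S†Cy' and y' − S†Cy', the Z₅ term y − y'; they sum to y. In
  -- X the Z₁ term contributes A†A(X − X₀)BB†, which is what the Z₂ and Z₃ terms lack.
  refine ⟨S† * S * y', y', y, X - X₀, A† * A * (X - X₀), ?_, ?_⟩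
  · have e1 : A† * S * (S† * S * y') * projR N * D * B† = -(A† * A * (X - X₀) * B * B†) := by
      have : A† * S * (S† * S * y') * projR N * D * B† = A† * (S * y' * projR N * D) * B† := by
        simp only [Matrix.mul_assoc, mul_mpInv_mul_assoc]
      rw [this, hSN, Matrix.mul_assoc C, hy'D, ← neg_eq_of_add_eq_zero_right hhom]
      simp only [Matrix.mul_assoc, Matrix.mul_neg, Matrix.neg_mul]
    rw [e1]
    simp only [projL, projR, Matrix.sub_mul, Matrix.mul_sub, Matrix.one_mul, Matrix.mul_one,
      Matrix.mul_assoc]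
    abel
  · have e1 : projL M * (S† * S * y') * projR N = S† * (C * y') := by
      rw [← hSN]
      simp only [← Matrix.mul_assoc, hSM]
    have e2 : projL M * projL S * y' = y' - S† * (C * y') := by
      have : projL S * y' = y' - S† * (S * y') := by
        rw [projL, Matrix.sub_mul, Matrix.one_mul, Matrix.mul_assoc]
      rw [← hCS, Matrix.mul_assoc, this, Matrix.mul_sub, projL_mul_of_mul hMy', ← Matrix.mul_assoc,
        hSM]
    have e3 : y * projR D = y - y' := by
      rw [projR, Matrix.mul_sub, Matrix.mul_one]
    rw [e1, e2, e3, hy]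
    abel

end TwoTerm

/-! ### Block ranks as projector equations -/

section Rank

variable {m n k l : Type*} [Fintype m] [Fintype n] [Fintype k] [Fintype l]

/-- Left multiplication of columns by a quaternion matrix, as a map of right vector spaces. -/
noncomputable def mulVecRight (A : Matrix m n ℍ[ℝ]) : (n → ℍ[ℝ]) →ₗ[ℍ[ℝ]ᵐᵒᵖ] (m → ℍ[ℝ]) :=
  Matrix.mulVecBilin ℝ ℍ[ℝ]ᵐᵒᵖ A

theorem mulVecRight_apply (A : Matrix m n ℍ[ℝ]) (x : n → ℍ[ℝ]) : mulVecRight A x = A *ᵥ x := rfl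

theorem rk_eq_finrank_range (A : Matrix m n ℍ[ℝ]) :
    rk A = Module.finrank ℍ[ℝ]ᵐᵒᵖ (LinearMap.range (mulVecRight A)) := by
  classical
  unfold rk
  suffices h : Submodule.span ℍ[ℝ]ᵐᵒᵖ (Set.range A.col) = LinearMap.range (mulVecRight A) by rw [h]
  apply le_antisymm
  · rw [Submodule.span_le]
    rintro _ ⟨j, rfl⟩
    exact ⟨Pi.single j 1, by simp [mulVecRight_apply]⟩
  · rintro _ ⟨x, rfl⟩
    rw [mulVecRight_apply, Matrix.mulVec_eq_sum]
    exact Submodule.sum_mem _ fun j _ =>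
      Submodule.smul_mem _ _ (Submodule.subset_span ⟨j, rfl⟩)

instance : Module.Finite ℍ[ℝ]ᵐᵒᵖ ℍ[ℝ] :=
  ⟨⟨{1}, by
    rw [eq_top_iff]
    rintro x -
    rw [Finset.coe_singleton, Submodule.mem_span_singleton]
    exact ⟨MulOpposite.op x, by simp⟩⟩⟩

/-- Project the block column space onto its lower coordinates. The image is the column space of B;
the kernel is a copy of `K`, the vectors w with (w, 0) in the block column space. So the rank is dim
K + rk B. Since K contains the column space of A, equality of ranks means K equals it, that is, C
maps ker B into it. -/
theorem rk_fromBlocks_eq_iff_exists (A : Matrix m n ℍ[ℝ]) (B : Matrix k l ℍ[ℝ])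
    (C : Matrix m l ℍ[ℝ]) :
    rk (.fromBlocks C A B 0) = rk A + rk B ↔ ∀ x, B *ᵥ x = 0 → ∃ y, A *ᵥ y = C *ᵥ x := by
  set f := mulVecRight (Matrix.fromBlocks C A B 0) with hf
  have hfa (z) : f z = Sum.elim (C *ᵥ (z ∘ Sum.inl) + A *ᵥ (z ∘ Sum.inr)) (B *ᵥ (z ∘ Sum.inl)) := by
    rw [hf, mulVecRight_apply, Matrix.fromBlocks_mulVec, Matrix.zero_mulVec, add_zero]
  let π : (m ⊕ k → ℍ[ℝ]) →ₗ[ℍ[ℝ]ᵐᵒᵖ] (k → ℍ[ℝ]) := LinearMap.funLeft _ _ Sum.inr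
  let ι : (m → ℍ[ℝ]) →ₗ[ℍ[ℝ]ᵐᵒᵖ] (m ⊕ k → ℍ[ℝ]) :=
    { toFun := fun x => Sum.elim x 0
      map_add' := fun x y => by ext (i | i) <;> simp
      map_smul' := fun r x => by ext (i | i) <;> simp }
  have hι : Function.Injective ι := fun x y h => by
    ext1 i
    exact congrFun h (Sum.inl i)
  let K := (LinearMap.range f).comap ι
  have hAK : LinearMap.range (mulVecRight A) ≤ K := by
    rintro _ ⟨y, rfl⟩
    refine ⟨Sum.elim 0 y, ?_⟩
    rw [hfa]
    simp [ι, mulVecRight_apply]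
  have hrank : rk (.fromBlocks C A B 0) = Module.finrank ℍ[ℝ]ᵐᵒᵖ K + rk B := by
    rw [rk_eq_finrank_range, ← hf, rk_eq_finrank_range,
      ← LinearMap.finrank_range_add_finrank_ker (π.domRestrict (LinearMap.range f)), add_comm]
    congr 1
    · have : K.map ι = (LinearMap.ker (π.domRestrict (LinearMap.range f))).map
          (LinearMap.range f).subtype := by
        ext w
        constructor
        · rintro ⟨x, hx, rfl⟩
          exact ⟨⟨ι x, hx⟩, rfl, rfl⟩
        · rintro ⟨⟨w, hw⟩, hw0, rfl⟩
          have : ι (w ∘ Sum.inl) = w := by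
            ext1 (i | i)
            · rfl
            · exact (congrFun hw0 i).symm
          exact ⟨w ∘ Sum.inl, by
            change ι (w ∘ Sum.inl) ∈ LinearMap.range f
            rw [this]
            exact hw, this⟩
      rw [(Submodule.equivMapOfInjective ι hι K).finrank_eq, this]
      exact (Submodule.equivMapOfInjective _ (Submodule.subtype_injective _) _).finrank_eq
    · suffices h : LinearMap.range (π.domRestrict (LinearMap.range f)) =
          LinearMap.range (mulVecRight B) by rw [h]
      ext w
      constructor
      · rintro ⟨⟨_, z, rfl⟩, rfl⟩
        refine ⟨z ∘ Sum.inl, ?_⟩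
        change _ = fun i => f z (Sum.inr i)
        rw [hfa]
        rfl
      · rintro ⟨x, rfl⟩
        refine ⟨⟨_, Sum.elim x 0, rfl⟩, ?_⟩
        change (fun i => f _ (Sum.inr i)) = _
        rw [hfa]
        rfl
  rw [hrank, rk_eq_finrank_range A, add_left_inj]
  constructor
  · intro h x hx
    have hK := Submodule.eq_of_le_of_finrank_eq hAK h.symm
    have : C *ᵥ x ∈ K := by
      refine ⟨Sum.elim x 0, ?_⟩
      rw [hfa]
      simp [ι, hx]
    rw [← hK] at this
    exact this
  · intro h
    suffices h : K = LinearMap.range (mulVecRight A) by rw [h]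
    apply le_antisymm _ hAK
    rintro w ⟨z, hz⟩
    rw [hfa] at hz
    have hz1 : C *ᵥ (z ∘ Sum.inl) + A *ᵥ (z ∘ Sum.inr) = w :=
      funext fun i => congrFun hz (Sum.inl i)
    have hz2 : B *ᵥ (z ∘ Sum.inl) = 0 := funext fun i => congrFun hz (Sum.inr i)
    obtain ⟨y, hy⟩ := h _ hz2
    refine ⟨y + z ∘ Sum.inr, ?_⟩
    rw [mulVecRight_apply, Matrix.mulVec_add, hy, hz1]

/-- The range of L_B is ker B and the kernel of R_A is the column space of A. -/
theorem rk_fromBlocks_eq_iff [DecidableEq m] [DecidableEq l] (A : Matrix m n ℍ[ℝ])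
    (B : Matrix k l ℍ[ℝ]) (C : Matrix m l ℍ[ℝ]) :
    rk (.fromBlocks C A B 0) = rk A + rk B ↔ projR A * C * projL B = 0 := by
  rw [rk_fromBlocks_eq_iff_exists]
  constructor
  · intro h
    apply Matrix.ext_of_mulVec_single
    intro j
    obtain ⟨y, hy⟩ := h (projL B *ᵥ Pi.single j 1) (by
      rw [Matrix.mulVec_mulVec, mul_projL, Matrix.zero_mulVec])
    rw [← Matrix.mulVec_mulVec, ← Matrix.mulVec_mulVec, ← hy, Matrix.mulVec_mulVec, projR_mul,
      Matrix.zero_mulVec, Matrix.zero_mulVec]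
  · intro h x hx
    have hx' : projL B *ᵥ x = x := by
      rw [projL, Matrix.sub_mulVec, Matrix.one_mulVec, ← Matrix.mulVec_mulVec, hx,
        Matrix.mulVec_zero, sub_zero]
    refine ⟨(A† * C) *ᵥ x, ?_⟩
    have := congrArg (· *ᵥ x) h
    simp only [← Matrix.mulVec_mulVec, hx', Matrix.zero_mulVec] at this
    rw [projR, Matrix.sub_mulVec, Matrix.one_mulVec, sub_eq_zero] at this
    rw [this]
    simp only [Matrix.mulVec_mulVec, Matrix.mul_assoc]

end Rank

/-- P factors through R_A and Q through L_B. A rank equality can thus be tested on any convenient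
annihilators, avoiding Moore–Penrose inverses of block matrices. -/
theorem mul_mul_eq_zero_of_projR_mul_mul_projL {m n k l o o' : Type*} [Fintype m] [Fintype n]
    [Fintype k] [Fintype l] [DecidableEq m] [DecidableEq l] {A : Matrix m n ℍ[ℝ]}
    {B : Matrix k l ℍ[ℝ]} {C : Matrix m l ℍ[ℝ]} (h : projR A * C * projL B = 0)
    {P : Matrix o m ℍ[ℝ]} {Q : Matrix l o' ℍ[ℝ]} (hP : P * A = 0) (hQ : B * Q = 0) :
    P * C * Q = 0 := by
  rw [← mul_projR_of_mul hP, ← projL_mul_of_mul hQ]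
  have : P * projR A * C * (projL B * Q) = P * (projR A * C * projL B) * Q := by
    simp only [Matrix.mul_assoc]
  rw [this, h, Matrix.mul_zero, Matrix.zero_mul]

namespace Coeffs

variable {m a k q p l s t u v : ℕ} (c : Coeffs m a k q p l s t u v)

/-! ### The two halves of the system -/

/-- With X₂ parametrized by equation 2, equation 1 becomes A₁X₁ − V₁A₁₁ = (this right side); its
solvability condition is linear in U. -/
theorem projR_mul_rhs₁_mul_projL (U : Matrix (Fin p) (Fin q) ℍ[ℝ]) :
    projR c.A₁ * (c.C₁ - projR c.A₂ * c.C₂ * c.B₂† * c.B₁ + c.A₂ * U * c.B₁) * projL c.A₁₁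
      = c.B₁₁ * U * c.C₁₁ - c.D₁₁ := by
  simp only [B₁₁, C₁₁, D₁₁, Matrix.mul_add, Matrix.mul_sub, Matrix.add_mul, Matrix.sub_mul,
    Matrix.mul_assoc]
  abel

theorem projR_mul_rhs₄_mul_projL (V : Matrix (Fin s) (Fin l) ℍ[ℝ]) :
    projR (c.A₄ * projL c.A₃) * (c.C₄ - c.A₄ * c.A₃† * c.C₃ - c.A₄ * V * c.B₃) * projL c.B₄
      = c.C₂₂ - c.A₂₂ * V * c.B₂₂ := by
  simp only [A₂₂, B₂₂, C₂₂, Matrix.mul_sub, Matrix.sub_mul, Matrix.mul_assoc]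

theorem eq₁_solution {U : Matrix (Fin p) (Fin q) ℍ[ℝ]} (hU : c.B₁₁ * U * c.C₁₁ = c.D₁₁)
    (W₄ : Matrix (Fin a) (Fin q) ℍ[ℝ]) (W₅ : Matrix (Fin m) (Fin q) ℍ[ℝ])
    (W₆ : Matrix (Fin a) (Fin k) ℍ[ℝ]) :
    c.A₁ * (c.A₁† * (c.C₁ - projR c.A₂ * c.C₂ * c.B₂† * c.B₁ + c.A₂ * U * c.B₁)
        + W₄ * c.A₁₁ + projL c.A₁ * W₆)
      - (-(projR c.A₂ * c.C₂ * c.B₂†) + c.A₂ * U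
        + (-(projR c.A₁ * (c.C₁ - projR c.A₂ * c.C₂ * c.B₂† * c.B₁ + c.A₂ * U * c.B₁) * c.A₁₁†)
          + c.A₁ * W₄ + W₅ * projR c.A₁₁) * projR c.B₂) * c.B₁ = c.C₁ := by
  have h := sylvester_solution ((c.projR_mul_rhs₁_mul_projL U).trans (sub_eq_zero.2 hU)) W₄ W₅ W₆
  rw [Matrix.add_mul _ (_ * projR c.B₂), Matrix.mul_assoc _ (projR c.B₂), ← A₁₁,
    sub_add_eq_sub_sub_swap, h, Matrix.add_mul, Matrix.neg_mul]
  abel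

theorem eq₄_solution {V : Matrix (Fin s) (Fin l) ℍ[ℝ]} (hV : c.A₂₂ * V * c.B₂₂ = c.C₂₂)
    (T₁ : Matrix (Fin s) (Fin v) ℍ[ℝ]) (T₂ : Matrix (Fin s) (Fin t) ℍ[ℝ])
    (T₃ : Matrix (Fin u) (Fin v) ℍ[ℝ]) :
    c.A₄ * (c.A₃† * c.C₃ + V * c.B₃ + projL c.A₃ *
        ((c.A₄ * projL c.A₃)† * (c.C₄ - c.A₄ * c.A₃† * c.C₃ - c.A₄ * V * c.B₃)
          + T₁ * c.B₄ + projL (c.A₄ * projL c.A₃) * T₂))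
      - (-(projR (c.A₄ * projL c.A₃) * (c.C₄ - c.A₄ * c.A₃† * c.C₃ - c.A₄ * V * c.B₃) * c.B₄†)
        + c.A₄ * projL c.A₃ * T₁ + T₃ * projR c.B₄) * c.B₄ = c.C₄ := by
  have h := sylvester_solution
    ((c.projR_mul_rhs₄_mul_projL V).trans (sub_eq_zero.2 hV.symm)) T₁ T₃ T₂
  rw [Matrix.mul_add, ← Matrix.mul_assoc c.A₄ (projL c.A₃), add_sub_assoc, h, Matrix.mul_add]
  simp only [Matrix.mul_assoc]
  abel

/-! ### The general solution solves the system -/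

variable {c}

/-- These are the terms in W₁, T₄, W₃, T₆ of the difference of the two expressions for X₃. -/
theorem A₃₃_mul_add_mul_B₃₃ (W₁ : Matrix (Fin p) (Fin l) ℍ[ℝ]) (T₄ : Matrix (Fin s) (Fin l) ℍ[ℝ])
    (W₃ : Matrix (Fin p) (Fin q) ℍ[ℝ]) (T₆ : Matrix (Fin p) (Fin l) ℍ[ℝ]) :
    c.A₃₃ * Matrix.fromRows W₁ T₄ + Matrix.fromCols W₃ T₆ * c.B₃₃
      = projL c.A₂ * W₁ - c.A₃ * projL c.A₂₂ * T₄ + W₃ * projR c.C₁₁ * c.B₂ - T₆ * projR c.B₃ := by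
  simp only [A₃₃, B₃₃, Matrix.fromCols_mul_fromRows, Matrix.neg_mul, Matrix.mul_neg,
    Matrix.mul_assoc]
  abel

theorem projR_mul_rhs_mul_projL (W : Matrix (Fin p) (Fin q) ℍ[ℝ])
    (T : Matrix (Fin s) (Fin l) ℍ[ℝ]) :
    projR c.A₃₃ * (c.E₁ - projL c.B₁₁ * W * c.B₂ + c.A₃ * T * projR c.B₂₂) * projL c.B₃₃
      = c.E - (c.A * W * c.B + c.C * T * c.D) := by
  simp only [A, B, C, D, E, Matrix.mul_add, Matrix.mul_sub, Matrix.add_mul, Matrix.sub_mul,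
    Matrix.mul_assoc, Matrix.neg_mul]
  abel

theorem fromRows_W₁_T₄ (P : Params m a k q p l s t u v) :
    Matrix.fromRows (c.W₁ P) (c.T₄ P) = c.colBlock P := by
  have h := Matrix.fromRows_toRows (c.colBlock P)
  have hW : c.W₁ P = (Matrix.fromCols 1 0 : Matrix (Fin p) (Fin p ⊕ Fin s) ℍ[ℝ]) * c.colBlock P :=
    rfl
  have hT : c.T₄ P = (Matrix.fromCols 0 1 : Matrix (Fin s) (Fin p ⊕ Fin s) ℍ[ℝ]) * c.colBlock P :=
    rfl
  rw [hW, hT, ← h, Matrix.fromCols_mul_fromRows, Matrix.fromCols_mul_fromRows]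
  simp

theorem fromCols_W₃_T₆ (P : Params m a k q p l s t u v) :
    Matrix.fromCols (c.W₃ P) (c.T₆ P) = c.rowBlock P := by
  have h := Matrix.fromCols_toCols (c.rowBlock P)
  have hW : c.W₃ P = c.rowBlock P * (Matrix.fromRows 1 0 : Matrix (Fin q ⊕ Fin l) (Fin q) ℍ[ℝ]) :=
    rfl
  have hT : c.T₆ P = c.rowBlock P * (Matrix.fromRows 0 1 : Matrix (Fin q ⊕ Fin l) (Fin l) ℍ[ℝ]) :=
    rfl
  rw [hW, hT, ← h, Matrix.fromCols_mul_fromRows, Matrix.fromCols_mul_fromRows]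
  simp

theorem ProjectorConditions.solX₃_eq (h : c.ProjectorConditions)
    (P : Params m a k q p l s t u v) : c.solX₃ P = c.solX₃' P := by
  obtain ⟨-, -, h1, h2, h3, h4⟩ := h
  have e1 : c.A * c.W₂ P * c.B + c.C * c.T₅ P * c.D = c.E :=
    two_term_solution rfl rfl rfl h1 h2 h3 h4 P.Z₁ P.Z₄ P.Z₅ P.Z₂ P.Z₃
  have e2 : c.A₃₃ * c.colBlock P + c.rowBlock P * c.B₃₃ = _ :=
    mul_add_mul_solution ((projR_mul_rhs_mul_projL _ _).trans (sub_eq_zero.2 e1.symm))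
      P.Z₇ P.Z₈ P.Z₆
  rw [← fromRows_W₁_T₄, ← fromCols_W₃_T₆, A₃₃_mul_add_mul_B₃₃, E₁, ← sub_eq_zero] at e2
  rw [← sub_eq_zero, ← e2, solX₃, solX₃', U₁, V₂]
  simp only [Matrix.mul_add, Matrix.add_mul, Matrix.mul_assoc]
  abel

theorem ProjectorConditions.isSolution (h : c.ProjectorConditions)
    (P : Params m a k q p l s t u v) :
    c.IsSolution (c.solX₁ P) (c.solX₂ P) (c.solX₃ P) (c.solX₄ P) (c.solX₅ P) := by
  have hX := h.solX₃_eq P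
  obtain ⟨⟨h1, h2, h3⟩, ⟨h4, h5, h6⟩, -⟩ := h
  refine ⟨c.eq₁_solution ?_ P.W₄ P.W₅ P.W₆, sylvester_solution h1 _ _ _, ?_,
    c.eq₄_solution ?_ P.T₁ P.T₂ P.T₃⟩
  · exact mul_mul_solution h3 h2 _ _
  -- Equation 2 holds by the form of the first expression for X₃, equation 3 by that of the second.
  · rw [hX]
    exact sylvester_solution h4 _ _ _
  · exact mul_mul_solution h5 h6 _ _

/-- Every solution is given by the general formula, and the projector conditions hold. -/
theorem IsSolution.exists_params {X₁ : Matrix (Fin a) (Fin k) ℍ[ℝ]}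
    {X₂ : Matrix (Fin m) (Fin q) ℍ[ℝ]} {X₃ : Matrix (Fin p) (Fin l) ℍ[ℝ]}
    {X₄ : Matrix (Fin s) (Fin t) ℍ[ℝ]} {X₅ : Matrix (Fin u) (Fin v) ℍ[ℝ]}
    (h : c.IsSolution X₁ X₂ X₃ X₄ X₅) :
    c.ProjectorConditions ∧ ∃ P : Params m a k q p l s t u v,
      X₁ = c.solX₁ P ∧ X₂ = c.solX₂ P ∧ X₃ = c.solX₃ P ∧ X₄ = c.solX₄ P ∧ X₅ = c.solX₅ P := by
  obtain ⟨h1, h2, h3, h4⟩ := h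
  have k1 := sylvester_cond h2
  have k4 := sylvester_cond h3
  obtain ⟨U₁, V₁, W₁, hX₃, hX₂⟩ := sylvester_param h2
  obtain ⟨V₂, T₆, U₂, hX₄, hX₃'⟩ := sylvester_param h3
  have h1' : c.A₁ * X₁ - V₁ * c.A₁₁
      = c.C₁ - projR c.A₂ * c.C₂ * c.B₂† * c.B₁ + c.A₂ * U₁ * c.B₁ := by
    rw [← h1, hX₂, A₁₁]
    simp only [Matrix.add_mul, Matrix.neg_mul, Matrix.mul_assoc]
    abel
  have h4' : c.A₄ * projL c.A₃ * U₂ - X₅ * c.B₄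
      = c.C₄ - c.A₄ * c.A₃† * c.C₃ - c.A₄ * V₂ * c.B₃ := by
    rw [← h4, hX₄]
    simp only [Matrix.mul_add, Matrix.mul_assoc]
    abel
  obtain ⟨W₄, W₅, W₆, hX₁, hV₁⟩ := sylvester_param h1'
  obtain ⟨T₁, T₃, T₂, hU₂, hX₅⟩ := sylvester_param h4'
  have hU : c.B₁₁ * U₁ * c.C₁₁ = c.D₁₁ :=
    sub_eq_zero.1 ((c.projR_mul_rhs₁_mul_projL U₁).symm.trans (sylvester_cond h1'))
  have hV : c.A₂₂ * V₂ * c.B₂₂ = c.C₂₂ :=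
    (sub_eq_zero.1 ((c.projR_mul_rhs₄_mul_projL V₂).symm.trans (sylvester_cond h4'))).symm
  obtain ⟨k3, k2⟩ := mul_mul_cond hU
  obtain ⟨k5, k6⟩ := mul_mul_cond hV
  obtain ⟨W₂, W₃, hU₁⟩ := mul_mul_param hU
  obtain ⟨T₄, T₅, hV₂⟩ := mul_mul_param hV
  -- Equations 2 and 3 were parametrized independently; here their values of X₃ are equated.
  have e2 : c.A₃₃ * Matrix.fromRows W₁ T₄ + Matrix.fromCols W₃ T₆ * c.B₃₃
      = c.E₁ - projL c.B₁₁ * W₂ * c.B₂ + c.A₃ * T₅ * projR c.B₂₂ := by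
    have := hX₃.symm.trans hX₃'
    rw [hU₁, hV₂, ← sub_eq_zero] at this
    rw [A₃₃_mul_add_mul_B₃₃, ← sub_eq_zero, ← this, E₁]
    simp only [Matrix.mul_add, Matrix.add_mul, Matrix.mul_assoc]
    abel
  have e1 : c.A * W₂ * c.B + c.C * T₅ * c.D = c.E :=
    (sub_eq_zero.1 ((projR_mul_rhs_mul_projL W₂ T₅).symm.trans (mul_add_mul_cond e2))).symm
  obtain ⟨Z₇, Z₈, Z₆, hcol, hrow⟩ := mul_add_mul_param e2
  obtain ⟨Z₁, Z₄, Z₅, Z₂, Z₃, hW₂, hT₅⟩ := two_term_param (M := c.M) (N := c.N) (S := c.S)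
    rfl rfl rfl e1
  refine ⟨⟨⟨k1, k2, k3⟩, ⟨k4, k5, k6⟩, two_term_cond rfl rfl e1⟩,
    ⟨W₄, W₅, W₆, T₁, T₂, T₃, Z₁, Z₂, Z₃, Z₄, Z₅, Z₆, Z₇, Z₈⟩, ?_⟩
  set P : Params m a k q p l s t u v :=
    ⟨W₄, W₅, W₆, T₁, T₂, T₃, Z₁, Z₂, Z₃, Z₄, Z₅, Z₆, Z₇, Z₈⟩ with hP
  have f1 : c.W₂ P = W₂ := hW₂.symm
  have f2 : c.T₅ P = T₅ := hT₅.symm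
  have f3 : Matrix.fromRows (c.W₁ P) (c.T₄ P) = Matrix.fromRows W₁ T₄ := by
    rw [fromRows_W₁_T₄, hcol, colBlock, f1, f2]
  have f4 : Matrix.fromCols (c.W₃ P) (c.T₆ P) = Matrix.fromCols W₃ T₆ := by
    rw [fromCols_W₃_T₆, hrow, rowBlock, f1, f2]
  obtain ⟨f5, f6⟩ := Matrix.fromRows_inj f3
  obtain ⟨f7, f8⟩ := Matrix.fromCols_inj f4
  have f9 : c.U₁ P = U₁ := by rw [Coeffs.U₁, f1, f7, ← hU₁]
  have f10 : c.V₂ P = V₂ := by rw [Coeffs.V₂, f2, f6, ← hV₂]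
  have f11 : c.V₁ P = V₁ := by rw [Coeffs.V₁, f9, hV₁]
  have f12 : c.U₂ P = U₂ := by rw [Coeffs.U₂, f10, hU₂]
  refine ⟨?_, ?_, ?_, ?_, ?_⟩
  · rw [solX₁, f9, hX₁]
  · rw [solX₂, f9, f11, hX₂]
  · rw [solX₃, f9, f5, hX₃]
  · rw [solX₄, f10, f12, hX₄]
  · rw [solX₅, f10, hX₅]

/-! ### The rank conditions -/

/-- Eliminating X₃ from equations 2 and 3 gives A₂A₃X₄ − X₂B₂B₃ = F. Each rank equality is the
solvability condition of one of the five equations now available or of several stacked together. -/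
theorem IsSolution.rankConditions {X₁ : Matrix (Fin a) (Fin k) ℍ[ℝ]}
    {X₂ : Matrix (Fin m) (Fin q) ℍ[ℝ]} {X₃ : Matrix (Fin p) (Fin l) ℍ[ℝ]}
    {X₄ : Matrix (Fin s) (Fin t) ℍ[ℝ]} {X₅ : Matrix (Fin u) (Fin v) ℍ[ℝ]}
    (h : c.IsSolution X₁ X₂ X₃ X₄ X₅) : c.RankConditions := by
  obtain ⟨h1, h2, h3, h4⟩ := h
  have hF : c.A₂ * c.A₃ * X₄ - X₂ * (c.B₂ * c.B₃) = c.A₂ * c.C₃ + c.C₂ * c.B₃ := by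
    rw [← h2, ← h3]
    simp only [Matrix.mul_sub, Matrix.sub_mul, Matrix.mul_assoc]
    abel
  have hsub {α β γ : Type} (X Y : Matrix α β ℍ[ℝ]) (Z W : Matrix α γ ℍ[ℝ]) :
      Matrix.fromCols X Z - Matrix.fromCols Y W = Matrix.fromCols (X - Y) (Z - W) := by
    ext i (j | j) <;> rfl
  have hsub' {α β γ : Type} (X Y : Matrix β α ℍ[ℝ]) (Z W : Matrix γ α ℍ[ℝ]) :
      Matrix.fromRows X Z - Matrix.fromRows Y W = Matrix.fromRows (X - Y) (Z - W) := by
    ext (i | i) j <;> rfl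
  have hsub'' {α β γ δ : Type} (X X' : Matrix α β ℍ[ℝ]) (Y Y' : Matrix α γ ℍ[ℝ])
      (Z Z' : Matrix δ β ℍ[ℝ]) (W W' : Matrix δ γ ℍ[ℝ]) :
      Matrix.fromBlocks X Y Z W - Matrix.fromBlocks X' Y' Z' W'
        = Matrix.fromBlocks (X - X') (Y - Y') (Z - Z') (W - W') := by
    ext (i | i) (j | j) <;> rfl
  refine ⟨?_, ?_, ?_, ?_, ?_, ?_, ?_, ?_, ?_, ?_⟩ <;> rw [rk_fromBlocks_eq_iff]
  · exact sylvester_cond h1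
  · exact sylvester_cond h2
  · exact sylvester_cond h3
  · exact sylvester_cond h4
  · apply sylvester_cond (X := .fromBlocks X₁ 0 0 X₃) (Y := X₂)
    simp [Matrix.fromCols_mul_fromBlocks, Matrix.mul_fromCols, hsub, h1, h2]
  · apply sylvester_cond (X := X₄) (Y := .fromBlocks X₃ 0 0 X₅)
    simp [Matrix.fromBlocks_mul_fromRows, Matrix.fromRows_mul, hsub', h3, h4]
  · apply sylvester_cond (X := .fromBlocks X₁ 0 0 X₄) (Y := X₂)
    simp [Matrix.fromCols_mul_fromBlocks, Matrix.mul_fromCols, hsub, h1, hF]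
  · apply sylvester_cond (X := X₄) (Y := .fromBlocks X₂ 0 0 X₅)
    simp [Matrix.fromBlocks_mul_fromRows, Matrix.fromRows_mul, hsub', h4, hF]
  · exact sylvester_cond hF
  · apply sylvester_cond (X := .fromBlocks X₁ 0 0 X₄) (Y := .fromBlocks X₂ 0 0 X₅)
    simp [Matrix.fromBlocks_multiply, hsub'', h1, h4, hF]

/-- The first six conditions come from the six equalities without F. The four with F give the rest:
`r7` yields R_M R_A E = 0, `r8` yields E L_B L_N = 0, `r9` yields R_C E L_B = 0 and `r10` yields R_A
E L_D = 0. -/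
theorem RankConditions.projectorConditions (h : c.RankConditions) : c.ProjectorConditions := by
  obtain ⟨r1, r2, r3, r4, r5, r6, r7, r8, r9, r10⟩ := h
  rw [rk_fromBlocks_eq_iff] at r1 r2 r3 r4 r5 r6 r7 r8 r9 r10
  have n1 : c.D₁₁ * projL c.C₁₁ = 0 := by
    have : c.B₁ * (projL c.A₁₁ * projL c.C₁₁) = 0 := by
      rw [← Matrix.mul_assoc, ← C₁₁, mul_projL]
    have h0 := mul_mul_eq_zero_of_projR_mul_mul_projL r1 (projR_mul c.A₁) this
    simp only [D₁₁, Matrix.mul_sub, Matrix.sub_mul, Matrix.mul_assoc, this, Matrix.mul_zero,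
      zero_sub, neg_eq_zero] at h0 ⊢
    exact h0
  have n2 : projR c.B₁₁ * c.D₁₁ = 0 := by
    have e1 : projR c.B₁₁ * projR c.A₁ * c.A₂ = 0 := by
      rw [Matrix.mul_assoc, ← B₁₁, projR_mul]
    have h0 := mul_mul_eq_zero_of_projR_mul_mul_projL r5
      (P := projR c.B₁₁ * projR c.A₁)
      -- (B₁, B₂) times this is R_{B₂}B₁L_{A₁₁} = A₁₁L_{A₁₁} = 0.
      (Q := Matrix.fromRows (projL c.A₁₁) (-(c.B₂† * c.B₁ * projL c.A₁₁)))
      (by rw [Matrix.mul_fromCols, e1, Matrix.mul_assoc, projR_mul, Matrix.mul_zero]; simp)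
      (by
        have := mul_projL c.A₁₁
        rw [A₁₁] at this
        nth_rw 1 [projR] at this
        rw [← A₁₁, Matrix.sub_mul, Matrix.one_mul, Matrix.sub_mul] at this
        rw [Matrix.fromCols_mul_fromRows, ← this]
        simp only [Matrix.mul_neg, Matrix.mul_assoc]
        abel)
    have e2 : projR c.B₁₁ * (projR c.A₁ * projR c.A₂) = projR c.B₁₁ * projR c.A₁ := by
      rw [← Matrix.mul_assoc, mul_projR_of_mul e1]
    have e3 (X : Matrix (Fin m) (Fin k) ℍ[ℝ]) :
        projR c.B₁₁ * (projR c.A₁ * (projR c.A₂ * X)) = projR c.B₁₁ * (projR c.A₁ * X) := by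
      simpa only [Matrix.mul_assoc] using congrArg (· * X) e2
    rw [Matrix.mul_fromCols, Matrix.fromCols_mul_fromRows] at h0
    simp only [D₁₁, Matrix.mul_sub, Matrix.sub_mul, Matrix.mul_assoc, Matrix.mul_neg, e3] at h0 ⊢
    rw [← neg_eq_zero, ← h0]
    abel
  have n3 : projR c.A₂₂ * c.C₂₂ = 0 := by
    have := mul_mul_eq_zero_of_projR_mul_mul_projL r4
      (P := projR c.A₂₂ * projR (c.A₄ * projL c.A₃))
      (by rw [Matrix.mul_assoc, ← A₂₂, projR_mul]) (mul_projL c.B₄)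
    have e1 (X : Matrix (Fin s) (Fin t) ℍ[ℝ]) :
        projR c.A₂₂ * (projR (c.A₄ * projL c.A₃) * (c.A₄ * X)) = 0 := by
      rw [← Matrix.mul_assoc (projR (c.A₄ * projL c.A₃)), ← A₂₂, projR_mul_assoc]
    simp only [C₂₂, Matrix.mul_sub, Matrix.sub_mul, Matrix.mul_assoc, e1, sub_zero] at this ⊢
    exact this
  have n4 : c.C₂₂ * projL c.B₂₂ = 0 := by
    have e1 : c.B₃ * (projL c.B₄ * projL c.B₂₂) = 0 := by
      rw [← Matrix.mul_assoc, ← B₂₂, mul_projL]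
    have h0 := mul_mul_eq_zero_of_projR_mul_mul_projL r6
      (P := Matrix.fromCols (-(projR (c.A₄ * projL c.A₃) * c.A₄ * c.A₃†))
        (projR (c.A₄ * projL c.A₃)))
      (Q := projL c.B₄ * projL c.B₂₂)
      (by
        have := projR_mul (c.A₄ * projL c.A₃)
        nth_rw 2 [projL] at this
        rw [Matrix.mul_sub, Matrix.mul_sub, Matrix.mul_one] at this
        rw [Matrix.fromCols_mul_fromRows, ← this]
        simp only [Matrix.neg_mul, Matrix.mul_assoc]
        abel)
      (by rw [Matrix.fromRows_mul, e1, mul_projL_assoc]; simp)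
    rw [Matrix.fromCols_mul_fromRows] at h0
    simp only [C₂₂, Matrix.mul_sub, Matrix.sub_mul, Matrix.mul_assoc, Matrix.add_mul,
      Matrix.neg_mul] at h0 ⊢
    rw [← h0]
    abel
  obtain ⟨X₁, X₂, X₃, g1, g2, hX₃⟩ : ∃ (X₁ : Matrix (Fin a) (Fin k) ℍ[ℝ])
      (X₂ : Matrix (Fin m) (Fin q) ℍ[ℝ]) (X₃ : Matrix (Fin p) (Fin l) ℍ[ℝ]),
      c.A₁ * X₁ - X₂ * c.B₁ = c.C₁ ∧
      c.A₂ * X₃ - X₂ * c.B₂ = c.C₂ ∧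
      X₃ = c.A₂† * c.C₂ + c.B₁₁† * c.D₁₁ * c.C₁₁† * c.B₂ := by
    have hU := mul_mul_solution n2 n1 0 0
    simp only [Matrix.mul_zero, Matrix.zero_mul, add_zero] at hU
    refine ⟨_, _, _, c.eq₁_solution hU 0 0 0, sylvester_solution r2 _ _ 0, ?_⟩
    rw [Matrix.mul_zero, add_zero]
  obtain ⟨X₃', X₄, X₅, g3, g4, hX₃'⟩ : ∃ (X₃' : Matrix (Fin p) (Fin l) ℍ[ℝ])
      (X₄ : Matrix (Fin s) (Fin t) ℍ[ℝ]) (X₅ : Matrix (Fin u) (Fin v) ℍ[ℝ]),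
      c.A₃ * X₄ - X₃' * c.B₃ = c.C₃ ∧
      c.A₄ * X₄ - X₅ * c.B₄ = c.C₄ ∧
      X₃' = -(projR c.A₃ * c.C₃ * c.B₃†) + c.A₃ * c.A₂₂† * c.C₂₂ * c.B₂₂† := by
    have hV := mul_mul_solution n3 n4 0 0
    simp only [Matrix.mul_zero, Matrix.zero_mul, add_zero] at hV
    refine ⟨_, _, _, sylvester_solution r3 _ 0 _, c.eq₄_solution hV 0 0 0, ?_⟩
    rw [Matrix.zero_mul, add_zero]
    simp only [Matrix.mul_assoc]
  -- Each half of the chain has been solved with zero parameters; E₁ measures their mismatch at X₃.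
  have hE₁ : c.E₁ = X₃' - X₃ := by
    rw [E₁, hX₃, hX₃']
    abel
  have hF : c.A₂ * c.C₃ + c.C₂ * c.B₃
      = c.A₂ * c.A₃ * X₄ - c.A₂ * c.E₁ * c.B₃ - X₂ * (c.B₂ * c.B₃) := by
    rw [← g2, ← g3, hE₁]
    simp only [Matrix.mul_sub, Matrix.sub_mul, Matrix.mul_assoc]
    abel
  -- These facts lift P to P₁ with P₁A₂ = P, and Q to Q' with B₃Q' = Q, while cancelling the
  -- contributions of A₄ and B₁ where needed.
  have hPA {o : ℕ} {P : Matrix (Fin o) (Fin p) ℍ[ℝ]} (h : P * projL c.A₂ = 0) :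
      P * c.A₂† * c.A₂ = P := by
    rw [Matrix.mul_assoc, mul_mpInv_mul_of_mul_projL h]
  have hPB {o : ℕ} {P : Matrix (Fin o) (Fin p) ℍ[ℝ]} (h : P * projL c.B₁₁ = 0) :
      P * c.B₁₁† * projR c.A₁ * c.A₂ = P := by
    rw [Matrix.mul_assoc, ← B₁₁, Matrix.mul_assoc, mul_mpInv_mul_of_mul_projL h]
  have hPA₄ {o : ℕ} {P : Matrix (Fin o) (Fin p) ℍ[ℝ]} (h : P * c.A₃ * projL c.A₂₂ = 0) :
      P * c.A₃ = P * c.A₃ * c.A₂₂† * projR (c.A₄ * projL c.A₃) * c.A₄ := by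
    rw [Matrix.mul_assoc _ _ c.A₄, ← A₂₂, Matrix.mul_assoc _ _ c.A₂₂,
      mul_mpInv_mul_of_mul_projL h]
  have hQB₃ {o : ℕ} {Q : Matrix (Fin l) (Fin o) ℍ[ℝ]} (h : projR c.B₃ * Q = 0) :
      c.B₃ * (c.B₃† * Q) = Q := mul_mpInv_mul_of_projR_mul h
  have hQB₂₂ {o : ℕ} {Q : Matrix (Fin l) (Fin o) ℍ[ℝ]} (h : projR c.B₂₂ * Q = 0) :
      c.B₃ * (projL c.B₄ * (c.B₂₂† * Q)) = Q := by
    rw [← Matrix.mul_assoc, ← B₂₂, mul_mpInv_mul_of_projR_mul h]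
  have hQB₁ {o : ℕ} {Q : Matrix (Fin l) (Fin o) ℍ[ℝ]} (h : projR c.C₁₁ * c.B₂ * Q = 0) :
      c.B₁ * (projL c.A₁₁ * (c.C₁₁† * (c.B₂ * Q))) = c.B₂ * Q := by
    rw [← Matrix.mul_assoc c.B₁, ← C₁₁, mul_mpInv_mul_of_projR_mul (by rw [← Matrix.mul_assoc, h])]
  -- When P₁, P₄ and Q₁, Q annihilate the coefficient blocks, everything on the right vanishes
  -- except the gap term P₁A₂E₁B₃Q, while a rank equality kills the left.
  have key {o o' : ℕ} (P₁ : Matrix (Fin o) (Fin m) ℍ[ℝ]) (P₄ : Matrix (Fin o) (Fin u) ℍ[ℝ])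
      (Q₁ : Matrix (Fin k) (Fin o') ℍ[ℝ]) (Q : Matrix (Fin t) (Fin o') ℍ[ℝ]) :
      P₁ * c.C₁ * Q₁ + P₁ * (c.A₂ * c.C₃ + c.C₂ * c.B₃) * Q + P₄ * c.C₄ * Q
        = P₁ * c.A₁ * (X₁ * Q₁) + (P₁ * (c.A₂ * c.A₃) + P₄ * c.A₄) * (X₄ * Q)
          - P₁ * X₂ * (c.B₁ * Q₁ + c.B₂ * c.B₃ * Q) - P₄ * X₅ * (c.B₄ * Q)
          - P₁ * c.A₂ * c.E₁ * (c.B₃ * Q) := by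
    rw [hF, ← g1, ← g4]
    simp only [Matrix.mul_sub, Matrix.sub_mul, Matrix.mul_add, Matrix.add_mul, Matrix.mul_assoc]
    abel
  -- Four cases: `v9` uses neither end of the chain, `v7` brings in equation 1, `v8` equation 4,
  -- `v10` both. Bringing in an end weakens the requirement on B₂Q (equation 1) or PA₃ (equation 4)
  -- and strengthens the other one on P or Q.
  have v9 {o o' : ℕ} {P : Matrix (Fin o) (Fin p) ℍ[ℝ]} {Q : Matrix (Fin l) (Fin o') ℍ[ℝ]}
      (hP : P * projL c.A₂ = 0) (hP' : P * c.A₃ = 0) (hQ : projR c.B₃ * Q = 0)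
      (hQ' : c.B₂ * Q = 0) : P * c.E₁ * Q = 0 := by
    have b1 : P * c.A₂† * (c.A₂ * c.A₃) = 0 := by rw [← Matrix.mul_assoc, hPA hP, hP']
    have b2 : c.B₂ * c.B₃ * (c.B₃† * Q) = 0 := by rw [Matrix.mul_assoc, hQB₃ hQ, hQ']
    have h0 := mul_mul_eq_zero_of_projR_mul_mul_projL r9 b1 b2
    have h1 := key (P * c.A₂†) 0 0 (c.B₃† * Q)
    simp only [b1, b2, h0, hPA hP, hQB₃ hQ, Matrix.zero_mul, Matrix.mul_zero, add_zero, sub_zero,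
      zero_sub] at h1
    exact neg_eq_zero.1 h1.symm
  have v7 {o o' : ℕ} {P : Matrix (Fin o) (Fin p) ℍ[ℝ]} {Q : Matrix (Fin l) (Fin o') ℍ[ℝ]}
      (hP : P * projL c.B₁₁ = 0) (hP' : P * c.A₃ = 0) (hQ : projR c.B₃ * Q = 0)
      (hQ' : projR c.C₁₁ * c.B₂ * Q = 0) : P * c.E₁ * Q = 0 := by
    have b1 : P * c.B₁₁† * projR c.A₁ * c.A₁ = 0 := by
      rw [Matrix.mul_assoc, projR_mul, Matrix.mul_zero]
    have b2 : P * c.B₁₁† * projR c.A₁ * (c.A₂ * c.A₃) = 0 := by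
      rw [← Matrix.mul_assoc, hPB hP, hP']
    have b3 : c.B₁ * -(projL c.A₁₁ * (c.C₁₁† * (c.B₂ * Q))) + c.B₂ * c.B₃ * (c.B₃† * Q) = 0 := by
      rw [Matrix.mul_neg, hQB₁ hQ', Matrix.mul_assoc, hQB₃ hQ, neg_add_cancel]
    have h0 := mul_mul_eq_zero_of_projR_mul_mul_projL r7 (P := P * c.B₁₁† * projR c.A₁)
      (Q := .fromRows (-(projL c.A₁₁ * (c.C₁₁† * (c.B₂ * Q)))) (c.B₃† * Q))
      (by rw [Matrix.mul_fromCols, b1, b2, Matrix.fromCols_zero])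
      (by rw [Matrix.fromCols_mul_fromRows, b3])
    rw [Matrix.mul_fromCols, Matrix.fromCols_mul_fromRows] at h0
    have h1 := key (P * c.B₁₁† * projR c.A₁) 0 (-(projL c.A₁₁ * (c.C₁₁† * (c.B₂ * Q))))
      (c.B₃† * Q)
    simp only [h0, b1, b2, b3, hPB hP, hQB₃ hQ, Matrix.zero_mul, Matrix.mul_zero, add_zero,
      sub_zero, zero_sub] at h1
    exact neg_eq_zero.1 h1.symm
  have v8 {o o' : ℕ} {P : Matrix (Fin o) (Fin p) ℍ[ℝ]} {Q : Matrix (Fin l) (Fin o') ℍ[ℝ]}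
      (hP : P * projL c.A₂ = 0) (hP' : P * c.A₃ * projL c.A₂₂ = 0) (hQ : projR c.B₂₂ * Q = 0)
      (hQ' : c.B₂ * Q = 0) : P * c.E₁ * Q = 0 := by
    have b1 : P * c.A₂† * (c.A₂ * c.A₃)
        + -(P * c.A₃ * c.A₂₂† * projR (c.A₄ * projL c.A₃)) * c.A₄ = 0 := by
      rw [← Matrix.mul_assoc, hPA hP, Matrix.neg_mul, ← hPA₄ hP', add_neg_cancel]
    have b2 : c.B₂ * c.B₃ * (projL c.B₄ * (c.B₂₂† * Q)) = 0 := by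
      rw [Matrix.mul_assoc, hQB₂₂ hQ, hQ']
    have b3 : c.B₄ * (projL c.B₄ * (c.B₂₂† * Q)) = 0 := mul_projL_assoc _ _
    have h0 := mul_mul_eq_zero_of_projR_mul_mul_projL r8
      (P := .fromCols (P * c.A₂†) (-(P * c.A₃ * c.A₂₂† * projR (c.A₄ * projL c.A₃))))
      (Q := projL c.B₄ * (c.B₂₂† * Q))
      (by rw [Matrix.fromCols_mul_fromRows, b1])
      (by rw [Matrix.fromRows_mul, b2, b3, Matrix.fromRows_zero])
    rw [Matrix.fromCols_mul_fromRows, Matrix.add_mul] at h0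
    have h1 := key (P * c.A₂†) (-(P * c.A₃ * c.A₂₂† * projR (c.A₄ * projL c.A₃))) 0
      (projL c.B₄ * (c.B₂₂† * Q))
    simp only [h0, b1, b2, b3, hPA hP, hQB₂₂ hQ, Matrix.zero_mul, Matrix.mul_zero, add_zero,
      zero_add, sub_zero, zero_sub] at h1
    exact neg_eq_zero.1 h1.symm
  have v10 {o o' : ℕ} {P : Matrix (Fin o) (Fin p) ℍ[ℝ]} {Q : Matrix (Fin l) (Fin o') ℍ[ℝ]}
      (hP : P * projL c.B₁₁ = 0) (hP' : P * c.A₃ * projL c.A₂₂ = 0) (hQ : projR c.B₂₂ * Q = 0)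
      (hQ' : projR c.C₁₁ * c.B₂ * Q = 0) : P * c.E₁ * Q = 0 := by
    have b1 : P * c.B₁₁† * projR c.A₁ * c.A₁ = 0 := by
      rw [Matrix.mul_assoc, projR_mul, Matrix.mul_zero]
    have b2 : P * c.B₁₁† * projR c.A₁ * (c.A₂ * c.A₃)
        + -(P * c.A₃ * c.A₂₂† * projR (c.A₄ * projL c.A₃)) * c.A₄ = 0 := by
      rw [← Matrix.mul_assoc, hPB hP, Matrix.neg_mul, ← hPA₄ hP', add_neg_cancel]
    have b3 : c.B₁ * -(projL c.A₁₁ * (c.C₁₁† * (c.B₂ * Q)))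
        + c.B₂ * c.B₃ * (projL c.B₄ * (c.B₂₂† * Q)) = 0 := by
      rw [Matrix.mul_neg, hQB₁ hQ', Matrix.mul_assoc, hQB₂₂ hQ, neg_add_cancel]
    have b4 : c.B₄ * (projL c.B₄ * (c.B₂₂† * Q)) = 0 := mul_projL_assoc _ _
    have h0 := mul_mul_eq_zero_of_projR_mul_mul_projL r10
      (P := .fromCols (P * c.B₁₁† * projR c.A₁)
        (-(P * c.A₃ * c.A₂₂† * projR (c.A₄ * projL c.A₃))))
      (Q := .fromRows (-(projL c.A₁₁ * (c.C₁₁† * (c.B₂ * Q)))) (projL c.B₄ * (c.B₂₂† * Q)))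
      (by rw [Matrix.fromCols_mul_fromBlocks, b1, b2, Matrix.mul_zero, add_zero,
        Matrix.fromCols_zero])
      (by rw [Matrix.fromBlocks_mul_fromRows, b3, b4, Matrix.zero_mul, add_zero,
        Matrix.fromRows_zero])
    rw [Matrix.fromCols_mul_fromBlocks, Matrix.fromCols_mul_fromRows, Matrix.mul_zero, add_zero,
      Matrix.add_mul, ← add_assoc] at h0
    have h1 := key (P * c.B₁₁† * projR c.A₁) (-(P * c.A₃ * c.A₂₂† * projR (c.A₄ * projL c.A₃)))
      (-(projL c.A₁₁ * (c.C₁₁† * (c.B₂ * Q)))) (projL c.B₄ * (c.B₂₂† * Q))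
    simp only [h0, b1, b2, b3, b4, hPB hP, hQB₂₂ hQ, Matrix.zero_mul, Matrix.mul_zero, add_zero,
      sub_zero, zero_sub] at h1
    exact neg_eq_zero.1 h1.symm
  -- The projectors around E₁ in the last four conditions satisfy the hypotheses of `v7`–`v10`, read
  -- off blockwise from R_X X = 0 and X L_X = 0.
  obtain ⟨a1, a2⟩ : projR c.A₃₃ * projL c.A₂ = 0 ∧ projR c.A₃₃ * (c.A₃ * projL c.A₂₂) = 0 := by
    have h0 := projR_mul c.A₃₃
    nth_rw 2 [A₃₃] at h0
    rwa [Matrix.mul_fromCols, ← Matrix.fromCols_zero, Matrix.fromCols_ext_iff, Matrix.mul_neg,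
      neg_eq_zero] at h0
  obtain ⟨a3, a4⟩ : projR c.C₁₁ * c.B₂ * projL c.B₃₃ = 0 ∧ projR c.B₃ * projL c.B₃₃ = 0 := by
    have h0 := mul_projL c.B₃₃
    nth_rw 1 [B₃₃] at h0
    rwa [Matrix.fromRows_mul, ← Matrix.fromRows_zero, Matrix.fromRows_ext_iff, Matrix.neg_mul,
      neg_eq_zero] at h0
  have a5 : projR c.A * (projR c.A₃₃ * projL c.B₁₁) = 0 := projR_mul c.A
  have a6 : c.B₂ * projL c.B₃₃ * projL c.B = 0 := mul_projL c.B
  have a7 : projR c.C * (projR c.A₃₃ * c.A₃) = 0 := by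
    have := projR_mul c.C
    nth_rw 2 [C] at this
    rwa [Matrix.mul_neg, neg_eq_zero] at this
  have a8 : projR c.B₂₂ * projL c.B₃₃ * projL c.D = 0 := mul_projL c.D
  have a9 : projR c.M * (projR c.A * (projR c.A₃₃ * c.A₃)) = 0 := by
    have := projR_mul c.M
    nth_rw 2 [M] at this
    rwa [C, Matrix.mul_neg, Matrix.mul_neg, neg_eq_zero] at this
  have a10 : projR c.B₂₂ * projL c.B₃₃ * projL c.B * projL c.N = 0 := mul_projL c.N
  refine ⟨⟨r2, n1, n2⟩, ⟨r3, n3, n4⟩, ?_, ?_, ?_, ?_⟩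
  · have := v7 (P := projR c.M * projR c.A * projR c.A₃₃) (Q := projL c.B₃₃)
      (by simp only [Matrix.mul_assoc, a5, Matrix.mul_zero])
      (by simp only [Matrix.mul_assoc, a9]) a4 a3
    simpa only [E, Matrix.mul_assoc] using this
  · have := v8 (P := projR c.A₃₃) (Q := projL c.B₃₃ * projL c.B * projL c.N) a1
      (by rw [Matrix.mul_assoc, a2]) (by simpa only [Matrix.mul_assoc] using a10)
      (by rw [← Matrix.mul_assoc, ← Matrix.mul_assoc, a6, Matrix.zero_mul])
    simpa only [E, Matrix.mul_assoc] using this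
  · have := v10 (P := projR c.A * projR c.A₃₃) (Q := projL c.B₃₃ * projL c.D)
      (by rw [Matrix.mul_assoc, a5])
      (by simp only [Matrix.mul_assoc, a2, Matrix.mul_zero])
      (by rw [← Matrix.mul_assoc, a8]) (by rw [← Matrix.mul_assoc, a3, Matrix.zero_mul])
    simpa only [E, Matrix.mul_assoc] using this
  · have := v9 (P := projR c.C * projR c.A₃₃) (Q := projL c.B₃₃ * projL c.B)
      (by rw [Matrix.mul_assoc, a1, Matrix.mul_zero]) (by rw [Matrix.mul_assoc, a7])
      (by rw [← Matrix.mul_assoc, a4, Matrix.zero_mul]) (by rw [← Matrix.mul_assoc, a6])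
    simpa only [E, Matrix.mul_assoc] using this

end Coeffs

end QuatSylvester

theorem theorem7p1 {m a k q p l s t u v : ℕ}
    (c : QuatSylvester.Coeffs m a k q p l s t u v) :
    List.TFAE [c.Consistent, c.RankConditions, c.ProjectorConditions] ∧
    (c.Consistent →
      (∀ P : QuatSylvester.Params m a k q p l s t u v, c.solX₃ P = c.solX₃' P) ∧
      ∀ X₁ X₂ X₃ X₄ X₅, c.IsSolution X₁ X₂ X₃ X₄ X₅ ↔
        ∃ P : QuatSylvester.Params m a k q p l s t u v,
          X₁ = c.solX₁ P ∧ X₂ = c.solX₂ P ∧ X₃ = c.solX₃ P ∧ X₄ = c.solX₄ P ∧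
            X₅ = c.solX₅ P) := by
  have h13 : c.Consistent → c.ProjectorConditions := fun ⟨_, _, _, _, _, h⟩ => h.exists_params.1
  refine ⟨?_, fun h => ⟨(h13 h).solX₃_eq, fun X₁ X₂ X₃ X₄ X₅ => ⟨fun hX => hX.exists_params.2, ?_⟩⟩⟩
  · tfae_have 1 → 2 := fun ⟨_, _, _, _, _, h⟩ => h.rankConditions
    tfae_have 2 → 3 := fun h => h.projectorConditions
    tfae_have 3 → 1 := fun h =>
      ⟨_, _, _, _, _, h.isSolution ⟨0, 0, 0, 0, 0, 0, 0, 0, 0, 0, 0, 0, 0, 0⟩⟩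
    tfae_finish
  · rintro ⟨P, rfl, rfl, rfl, rfl, rfl⟩
    exact (h13 h).isSolution P
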